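/- Let $3<p<5$ and $s_p=\frac32-\frac2{p-1}$. Let $R_W\ge 0$ and let $W\in C^2(\{x\in\mathbb R^3:|x|>R_W\})$ be a real-valued radial function with $|W(x)|\lesssim |x|^{-1}$ and $|\nabla W(x)|\lesssim|x|^{-2}$ for large $|x|$. Let $C_4,C_5$ be constants. Then there is a constant $R_0>R_W$, depending only on $p$, $C_4$, $C_5$ and $W$ (with its domain $|x|>R_W$), such that the following holds. Let $F:[0,\infty)\times\mathbb R\to\mathbb R$ be any continuous function with $$|F(r,a)|\le |a|^p,\qquad |F(r,a)-F(r,b)|\le C_5|a-b|\left(|a|^{p-1}+|b|^{p-1}\right)\qquad(r\ge0,\ a,b\in\mathbb R),$$ and such that $-\Delta W=F(|x|,W)$ for $|x|>R_W$. Let $u$ be a real-valued radial solution of $\partial_t^2u-\Delta u=F(|x|,u)$ defined for all $t\in\mathbb R$; that is, $(u,\partial_tu)\in C(\mathbb R;\dot H^{s_p}\times\dot H^{s_p-1}(\mathbb R^3))$, the norm of $u$ in $L^{\frac{2p}{1+s_p}}_tL^{\frac{2p}{2-s_p}}_x(J\times\mathbb R^3)$ is finite for every bounded closed interval $J$, and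 for all $t,t_0\in\mathbb R$ $$u(t)=\cos\big((t-t_0)\sqrt{-\Delta}\big)u(t_0)+\frac{\sin\big((t-t_0)\sqrt{-\Delta}\big)}{\sqrt{-\Delta}}\partial_tu(t_0)+\int_{t_0}^t\frac{\sin\big((t-\tau)\sqrt{-\Delta}\big)}{\sqrt{-\Delta}}F(|\cdot|,u(\tau))\,d\tau$$ in the sense of tempered distributions. Suppose that (I) for each $t\in\mathbb R$, $\nabla u(\cdot,t)$ and $\partial_tu(\cdot,t)$ are functions on $\mathbb R^3\setminus\{0\}$ and, for every $r>0$, $$\int_{r<|x|<4r}\left(|\nabla u(x,t)|^2+|\partial_tu(x,t)|^2\right)dx\le C_4r^{-1};$$ (II) there are constants $C,\rho$ such that $|u(x,t)-W(x)|\le C|x|^{2-p}$ for all $t\in\mathbb R$ and (almost) all $|x|>\rho$. Then for every $t\in\mathbb R$ we have $u(x,t)-W(x)=0$ for (almost) every $x$ with $|x|>R_0$, and $\partial_tu(\cdot,t)=0$ on $\{|x|>R_0\}$. -/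

import Mathlib

open MeasureTheory Filter Topology
open scoped SchwartzMap FourierTransform ENNReal Laplacian

noncomputable section

namespace RadialWave

/-- Three-dimensional Euclidean space. -/
abbrev E3 : Type := EuclideanSpace ℝ (Fin 3)

/-- The critical Sobolev exponent `s_p = 3/2 - 2/(p-1)`. -/
def sp (p : ℝ) : ℝ := 3 / 2 - 2 / (p - 1)

/-- `f` is radial on `Ω`: its value depends only on `|x|`. -/
def IsRadialOn (f : E3 → ℝ) (Ω : Set E3) : Prop :=
  ∀ x ∈ Ω, ∀ y ∈ Ω, ‖x‖ = ‖y‖ → f x = f y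

/-- The tempered distribution `T` is the function `f`: every Schwartz function `φ` is integrable
against `f`, and `T φ = ∫ φ f`. -/
def IsRepresentedBy (T : 𝓢'(E3, ℂ)) (f : E3 → ℂ) : Prop :=
  ∀ φ : 𝓢(E3, ℂ), Integrable (fun x => φ x * f x) ∧ T φ = ∫ x, φ x * f x

/-- The restriction of the distribution `T` to the open set `Ω` is the locally integrable real
function `f`. -/
def IsRepresentedOn (T : 𝓢'(E3, ℂ)) (f : E3 → ℝ) (Ω : Set E3) : Prop :=
  LocallyIntegrableOn f Ω ∧
    ∀ φ : 𝓢(E3, ℂ), HasCompactSupport (φ : E3 → ℂ) → tsupport (φ : E3 → ℂ) ⊆ Ω →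
      T φ = ∫ x, φ x * (f x : ℂ)

/-- `g` is the weak gradient of `f` on the open set `Ω`. -/
def IsWeakGradientOn (f : E3 → ℝ) (g : E3 → E3) (Ω : Set E3) : Prop :=
  LocallyIntegrableOn f Ω ∧ LocallyIntegrableOn g Ω ∧
    ∀ φ : E3 → ℝ, ContDiff ℝ (⊤ : ℕ∞) φ → HasCompactSupport φ → tsupport φ ⊆ Ω →
      ∀ e : E3, ∫ x, f x * fderiv ℝ φ x e = - ∫ x, inner ℝ (g x) e * φ x

/-- The homogeneous Sobolev norm `‖T‖_{Ḣ^s} = ‖ |2πξ|^s 𝓕T ‖_{L²}`; it is `∞` unless `𝓕T` is a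
function `g` (which is then unique up to null sets) with `|2πξ|^s g ∈ L²`. -/
def homSobolevENorm (s : ℝ) (T : 𝓢'(E3, ℂ)) : ℝ≥0∞ :=
  ⨅ (g : E3 → ℂ) (_ : IsRepresentedBy (𝓕 T) g),
    (∫⁻ ξ, ENNReal.ofReal ((2 * Real.pi * ‖ξ‖) ^ (2 * s)) * ‖g ξ‖ₑ ^ 2) ^ (1 / 2 : ℝ)

/-- A curve of distributions lies in `C(ℝ; Ḣ^s)`. -/
def ContinuousInHomSobolev (s : ℝ) (T : ℝ → 𝓢'(E3, ℂ)) : Prop :=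
  (∀ t, homSobolevENorm s (T t) < ⊤) ∧
    ∀ t₀, Tendsto (fun t => homSobolevENorm s (T t - T t₀)) (𝓝 t₀) (𝓝 0)

/-- The mixed norm `‖u‖_{L^q_t L^r_x(J × ℝ³)}`, for finite positive exponents. -/
def mixedENorm (q r : ℝ) (J : Set ℝ) (u : ℝ → E3 → ℝ) : ℝ≥0∞ :=
  (∫⁻ t in J, (∫⁻ x, ‖u t x‖ₑ ^ r) ^ (q / r)) ^ (1 / q)

/-- The norm `‖u‖_{Y(J)}`, `Y(J) = L^{2p/(1+s_p)} L^{2p/(2-s_p)}(J × ℝ³)`. -/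
def yENorm (p : ℝ) (J : Set ℝ) (u : ℝ → E3 → ℝ) : ℝ≥0∞ :=
  mixedENorm (2 * p / (1 + sp p)) (2 * p / (2 - sp p)) J u

/-- The symbol `cos(t|2πξ|)` of `cos(t√-Δ)`. -/
def cosSymbol (t : ℝ) (ξ : E3) : ℂ := (Real.cos (t * (2 * Real.pi * ‖ξ‖)) : ℂ)

/-- The symbol `sin(t|2πξ|)/|2πξ|` of `sin(t√-Δ)/√-Δ`, with its limit `t` at `ξ = 0`. -/
def sinSymbol (t : ℝ) (ξ : E3) : ℂ := (t * Real.sinc (t * (2 * Real.pi * ‖ξ‖)) : ℝ)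

/-- The first component of the free wave propagator,
`S_{L,0}(t)(f₀, f₁) = cos(t√-Δ) f₀ + (sin(t√-Δ)/√-Δ) f₁`. -/
def freeWave (t : ℝ) (f₀ f₁ : 𝓢'(E3, ℂ)) : 𝓢'(E3, ℂ) :=
  TemperedDistribution.fourierMultiplierCLM ℂ (cosSymbol t) f₀ +
    TemperedDistribution.fourierMultiplierCLM ℂ (sinSymbol t) f₁

/-- `(u, ∂ₜu)` is a solution, on the whole time axis, of `∂ₜ²u - Δu = F(|x|,u)`. Here `u t` is the
function `u(·,t)`, `U t` is `u(·,t)` as a tempered distribution, and `ut t` is the tempered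
distribution `∂ₜu(·,t)`. -/
structure IsGlobalSolution (p : ℝ) (F : ℝ → ℝ → ℝ) (u : ℝ → E3 → ℝ)
    (U ut : ℝ → 𝓢'(E3, ℂ)) : Prop where
  measurable : AEStronglyMeasurable (fun z : ℝ × E3 => u z.1 z.2)
  represents : ∀ t, IsRepresentedBy (U t) (fun x => (u t x : ℂ))
  /-- `ut` is the time derivative of `u`, in the sense of distributions in `x`. -/
  time_deriv : ∀ t (φ : 𝓢(E3, ℂ)), HasDerivAt (fun τ => U τ φ) (ut t φ) t
  continuous_u : ContinuousInHomSobolev (sp p) U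
  continuous_ut : ContinuousInHomSobolev (sp p - 1) ut
  finite_y : ∀ a b : ℝ, yENorm p (Set.Icc a b) u < ⊤
  /-- The integral equation, as an identity of tempered distributions: the Duhamel term is tested
  against `φ` through the self-adjointness of `sin((t-τ)√-Δ)/√-Δ`. -/
  duhamel : ∀ (t t₀ : ℝ) (φ : 𝓢(E3, ℂ)),
    U t φ = freeWave (t - t₀) (U t₀) (ut t₀) φ +
      ∫ τ in t₀..t, ∫ x, (F ‖x‖ (u τ x) : ℂ) *
        SchwartzMap.fourierMultiplierCLM ℂ (sinSymbol (t - τ)) φ x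

/-- Away from the origin `f` has a weak gradient `∇f`, `f₁` is a function, and
`∫_{r<|x|<4r} (|∇f|² + |f₁|²) dx ≤ C r⁻¹` for every `r > 0`. -/
def HasLocalEnergyBound (C : ℝ) (f : E3 → ℝ) (f₁ : 𝓢'(E3, ℂ)) : Prop :=
  ∃ (g : E3 → E3) (v : E3 → ℝ),
    IsWeakGradientOn f g {0}ᶜ ∧ IsRepresentedOn f₁ v {0}ᶜ ∧
    ∀ r : ℝ, 0 < r →
      ∫⁻ x in {x : E3 | r < ‖x‖ ∧ ‖x‖ < 4 * r}, (‖g x‖ₑ ^ 2 + ‖v x‖ₑ ^ 2)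
        ≤ ENNReal.ofReal (C * r⁻¹)

end RadialWave

end

/-!
Tested against `ϕ(|x|)/|x|`, the radial wave equation becomes the one-dimensional one, so as long as
the support of `ϕ` stays off the origin the propagators act by d'Alembert's formula. Adding the
Duhamel formulas from `t` to `t + a` and from `t` to `t - a` eliminates `∂ₜu`, and any stationary
function `V` satisfies the same identity with forcing `-ΔV`. As `a → ∞`, the pairings of `u - W`
with `ϕ` translated by `a` vanish, because `u - W = O(|x|^{q-1})` uniformly in time, where
`q = 3 - p < 0`. What remains is a comparison principle: if `|F(|x|,u) + ΔW| ≤ ΔV` for a decaying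
barrier `V`, then `|u - W| ≤ V`.

The energy bound yields `|u| ≲ 1/|x|`, so `|u - W| ≤ A |x|^{q-1}` implies
`|F(|x|,u) - F(|x|,W)| ≤ K A |x|^{2q-3}`, and the barrier `c |x|^{2q-1}`, `c = K A / (2q(2q-1))`,
improves the constant `A` to `A/2` outside a ball of large radius independent of `u`. Iterating
gives `u = W` there at all times, whence `∂ₜu = 0`.
-/

noncomputable section

namespace RadialWave

section TemperateGrowth

variable {E F : Type*} [NormedAddCommGroup E] [NormedSpace ℝ E] [NormedAddCommGroup F]
  [NormedSpace ℝ F]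

/-- Polynomial growth of the derivatives up to order `n`: the version of
`Function.HasTemperateGrowth` that an induction on the order can carry. -/
structure HasTemperateGrowthUpTo (n : ℕ) (f : E → F) : Prop where
  contDiff : ContDiff ℝ n f
  norm_iteratedFDeriv_le : ∃ (k : ℕ) (C : ℝ), 0 ≤ C ∧
    ∀ i ≤ n, ∀ x, ‖iteratedFDeriv ℝ i f x‖ ≤ C * (1 + ‖x‖) ^ k

lemma HasTemperateGrowthUpTo.of_hasTemperateGrowth {f : E → F} (hf : f.HasTemperateGrowth)
    (n : ℕ) : HasTemperateGrowthUpTo n f :=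
  ⟨hf.1.of_le (mod_cast le_top), hf.norm_iteratedFDeriv_le_uniform n⟩

lemma hasTemperateGrowth_of_forall_upTo {f : E → F} (h : ∀ n, HasTemperateGrowthUpTo n f) :
    f.HasTemperateGrowth := by
  refine ⟨contDiff_infty.2 fun n => (h n).contDiff, fun n => ?_⟩
  obtain ⟨k, C, -, hC⟩ := (h n).norm_iteratedFDeriv_le
  exact ⟨k, C, hC n le_rfl⟩

lemma HasTemperateGrowthUpTo.smul {n : ℕ} {f : E → ℝ} {g : E → F}
    (hf : HasTemperateGrowthUpTo n f) (hg : HasTemperateGrowthUpTo n g) :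
    HasTemperateGrowthUpTo n (fun x => f x • g x) := by
  refine ⟨hf.contDiff.smul hg.contDiff, ?_⟩
  obtain ⟨k, C, hC, hf'⟩ := hf.norm_iteratedFDeriv_le
  obtain ⟨l, D, hD, hg'⟩ := hg.norm_iteratedFDeriv_le
  refine ⟨k + l, 2 ^ n * (C * D), by positivity, fun i hi x => ?_⟩
  calc ‖iteratedFDeriv ℝ i (fun x => f x • g x) x‖
      ≤ ∑ m ∈ Finset.range (i + 1), (i.choose m : ℝ) * ‖iteratedFDeriv ℝ m f x‖ *
          ‖iteratedFDeriv ℝ (i - m) g x‖ :=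
        norm_iteratedFDeriv_smul_le (hf.contDiff.of_le (mod_cast hi))
          (hg.contDiff.of_le (mod_cast hi)) x (le_refl (i : WithTop ℕ∞))
    _ ≤ ∑ m ∈ Finset.range (i + 1), (i.choose m : ℝ) * (C * (1 + ‖x‖) ^ k) *
          (D * (1 + ‖x‖) ^ l) := by
        refine Finset.sum_le_sum fun m hm => ?_
        have hmi : m ≤ i := Finset.mem_range_succ_iff.1 hm
        gcongr
        · exact hf' m (hmi.trans hi) x
        · exact hg' (i - m) (by omega) x
    _ = 2 ^ i * (C * D) * (1 + ‖x‖) ^ (k + l) := by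
        rw [← Finset.sum_mul, ← Finset.sum_mul, ← Nat.cast_sum, Nat.sum_range_choose, pow_add]
        push_cast
        ring
    _ ≤ 2 ^ n * (C * D) * (1 + ‖x‖) ^ (k + l) := by
        gcongr
        norm_num

lemma HasTemperateGrowthUpTo.succ_of_fderiv {n : ℕ} {f : E → F} (hd : Differentiable ℝ f)
    (hb : ∃ (k : ℕ) (C : ℝ), ∀ x, ‖f x‖ ≤ C * (1 + ‖x‖) ^ k)
    (hf : HasTemperateGrowthUpTo n (fderiv ℝ f)) : HasTemperateGrowthUpTo (n + 1) f := by
  refine ⟨?_, ?_⟩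
  · rw [Nat.cast_add, Nat.cast_one, contDiff_succ_iff_fderiv]
    exact ⟨hd, by simp, hf.contDiff⟩
  · obtain ⟨k, C, hC⟩ := hb
    obtain ⟨l, D, hD, hf'⟩ := hf.norm_iteratedFDeriv_le
    refine ⟨k + l, |C| + D, by positivity, fun i hi x => ?_⟩
    have hx : (1 : ℝ) ≤ 1 + ‖x‖ := by linarith [norm_nonneg x]
    rcases i with _ | i
    · calc ‖iteratedFDeriv ℝ 0 f x‖ = ‖f x‖ := norm_iteratedFDeriv_zero
        _ ≤ C * (1 + ‖x‖) ^ k := hC x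
        _ ≤ (|C| + D) * (1 + ‖x‖) ^ (k + l) := by
          gcongr
          · linarith [le_abs_self C]
          · omega
    · calc ‖iteratedFDeriv ℝ (i + 1) f x‖ = ‖iteratedFDeriv ℝ i (fderiv ℝ f) x‖ :=
          norm_iteratedFDeriv_fderiv.symm
        _ ≤ D * (1 + ‖x‖) ^ l := hf' i (by omega) x
        _ ≤ (|C| + D) * (1 + ‖x‖) ^ (k + l) := by
          gcongr
          · linarith [abs_nonneg C]
          · omega

/-- The derivatives of the sequence stay in the module it spans over the temperate functions. -/
lemma hasTemperateGrowth_of_hasFDerivAt_smul {f : ℕ → E → ℝ} {L : ℕ → E → E →L[ℝ] ℝ}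
    (hd : ∀ k x, HasFDerivAt (f k) (f (k + 1) x • L k x) x)
    (hb : ∀ k, ∃ (m : ℕ) (C : ℝ), ∀ x, ‖f k x‖ ≤ C * (1 + ‖x‖) ^ m)
    (hL : ∀ k, (L k).HasTemperateGrowth) (k : ℕ) : (f k).HasTemperateGrowth := by
  have hdiff : ∀ k, Differentiable ℝ (f k) := fun k x => (hd k x).differentiableAt
  refine hasTemperateGrowth_of_forall_upTo fun n => ?_
  induction n generalizing k with
  | zero =>
    obtain ⟨m, C, hC⟩ := hb k
    refine ⟨contDiff_zero.2 (hdiff k).continuous, m, |C|, abs_nonneg C, fun i hi x => ?_⟩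
    obtain rfl := Nat.le_zero.1 hi
    rw [norm_iteratedFDeriv_zero]
    exact (hC x).trans (by gcongr; exact le_abs_self C)
  | succ n ih =>
    refine .succ_of_fderiv (hdiff k) (hb k) ?_
    rw [show fderiv ℝ (f k) = fun x => f (k + 1) x • L k x from funext fun x => (hd k x).fderiv]
    exact (ih (k + 1)).smul (.of_hasTemperateGrowth (hL k) n)

end TemperateGrowth

section RadialCalculus

variable {E : Type*} [NormedAddCommGroup E] [InnerProductSpace ℝ E]

lemma hasFDerivAt_norm {x : E} (hx : x ≠ 0) :
    HasFDerivAt (fun x : E => ‖x‖) (‖x‖⁻¹ • innerSL ℝ x) x := by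
  have hsqrt := (hasStrictFDerivAt_norm_sq x).hasFDerivAt.sqrt (by simpa using hx)
  simp only [Real.sqrt_sq (norm_nonneg _)] at hsqrt
  convert! hsqrt using 1
  rw [← Nat.cast_smul_eq_nsmul ℝ, smul_smul]
  congr 1
  field_simp
  simp

lemma hasFDerivAt_comp_norm {g : ℝ → ℝ} {g' : ℝ} {x : E} (hx : x ≠ 0)
    (hg : HasDerivAt g g' ‖x‖) :
    HasFDerivAt (fun x : E => g ‖x‖) ((g' / ‖x‖) • innerSL ℝ x) x := by
  convert! hg.comp_hasFDerivAt x (hasFDerivAt_norm hx) using 1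
  rw [smul_smul, div_eq_mul_inv]

lemma hasFDerivAt_comp_norm_of_hasDerivAt_mul {h m : ℝ → ℝ} (hd : ∀ ρ, HasDerivAt h (ρ * m ρ) ρ)
    (x : E) : HasFDerivAt (fun x : E => h ‖x‖) (m ‖x‖ • innerSL ℝ x) x := by
  rcases eq_or_ne x 0 with rfl | hx
  · have h0 : HasDerivAt h 0 ‖(0 : E)‖ := by simpa using hd 0
    have hlo := h0.isLittleO.comp_tendsto (k := fun y : E => ‖y‖) (l' := 𝓝 0)
      (by simpa using (continuous_norm (E := E)).tendsto 0)
    refine HasFDerivAt.of_isLittleO (Asymptotics.isLittleO_norm_right.1 ?_)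
    simpa [Function.comp_def] using hlo
  · convert! hasFDerivAt_comp_norm hx (hd ‖x‖) using 2
    field_simp

end RadialCalculus

section Symbols

/-- The kernels `∫₀¹ (1 - z²)ᵏ cos (zρ) dz`: even functions of `ρ`, starting with `sinc` and
linked by a derivative recursion, which make `sinc ‖x‖` accessible to the chain rule at `0`. -/
def besselKernel (k : ℕ) (ρ : ℝ) : ℝ := ∫ z in (0 : ℝ)..1, (1 - z ^ 2) ^ k * Real.cos (z * ρ)

lemma besselKernel_zero (ρ : ℝ) : besselKernel 0 ρ = Real.sinc ρ := by
  rcases eq_or_ne ρ 0 with rfl | h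
  · simp [besselKernel]
  · simp only [besselKernel, pow_zero, one_mul]
    rw [Real.sinc_of_ne_zero h, intervalIntegral.integral_comp_mul_right (fun x => Real.cos x) h]
    simp [div_eq_inv_mul]

lemma abs_one_sub_sq_pow_le {z : ℝ} (hz : |z| ≤ 1) (k : ℕ) : |(1 - z ^ 2) ^ k| ≤ 1 := by
  have hz2 : z ^ 2 ≤ 1 := (sq_le_one_iff_abs_le_one z).2 hz
  rw [abs_pow]
  exact pow_le_one₀ (abs_nonneg _) (abs_le.2 ⟨by linarith, by linarith [sq_nonneg z]⟩)

lemma abs_le_one_of_mem_uIoc {z : ℝ} (hz : z ∈ Set.uIoc (0 : ℝ) 1) : |z| ≤ 1 := by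
  rw [Set.uIoc_of_le zero_le_one] at hz
  exact abs_le.2 ⟨by linarith [hz.1], hz.2⟩

lemma abs_besselKernel_le (k : ℕ) (ρ : ℝ) : |besselKernel k ρ| ≤ 1 := by
  have h := intervalIntegral.norm_integral_le_of_norm_le_const (a := 0) (b := 1) (C := 1)
    (f := fun z : ℝ => (1 - z ^ 2) ^ k * Real.cos (z * ρ)) fun z hz => by
      rw [norm_mul]
      exact mul_le_one₀ (abs_one_sub_sq_pow_le (abs_le_one_of_mem_uIoc hz) k) (norm_nonneg _)
        (Real.abs_cos_le_one _)
  simpa [besselKernel] using h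

lemma hasDerivAt_besselKernel_integral (k : ℕ) (ρ : ℝ) :
    HasDerivAt (besselKernel k)
      (∫ z in (0 : ℝ)..1, (1 - z ^ 2) ^ k * (-Real.sin (z * ρ) * z)) ρ := by
  refine (intervalIntegral.hasDerivAt_integral_of_dominated_loc_of_deriv_le
    (F := fun ρ z => (1 - z ^ 2) ^ k * Real.cos (z * ρ))
    (F' := fun ρ z => (1 - z ^ 2) ^ k * (-Real.sin (z * ρ) * z)) (bound := fun _ => 1)
    univ_mem ?_ ?_ ?_ ?_ intervalIntegrable_const ?_).2
  · exact Eventually.of_forall fun x => Continuous.aestronglyMeasurable (by fun_prop)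
  · exact Continuous.intervalIntegrable (by fun_prop) _ _
  · exact Continuous.aestronglyMeasurable (by fun_prop)
  · refine Eventually.of_forall fun z hz x _ => ?_
    have hz1 := abs_le_one_of_mem_uIoc hz
    rw [norm_mul, norm_mul, norm_neg]
    exact mul_le_one₀ (abs_one_sub_sq_pow_le hz1 k) (by positivity)
      (mul_le_one₀ (Real.abs_sin_le_one _) (norm_nonneg _) hz1)
  · refine Eventually.of_forall fun z _ x _ => ?_
    have hz : HasDerivAt (fun x : ℝ => z * x) z x := by simpa using (hasDerivAt_id x).const_mul z
    exact hz.cos.const_mul _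

lemma hasDerivAt_one_sub_sq_pow_mul_sin (k : ℕ) (ρ z : ℝ) :
    HasDerivAt (fun z : ℝ => (1 - z ^ 2) ^ (k + 1) / (2 * (k + 1)) * Real.sin (z * ρ))
      ((1 - z ^ 2) ^ k * (-Real.sin (z * ρ) * z)
        + ρ / (2 * (k + 1)) * ((1 - z ^ 2) ^ (k + 1) * Real.cos (z * ρ))) z := by
  have hlin : HasDerivAt (fun z : ℝ => z * ρ) ρ z := by simpa using (hasDerivAt_id z).mul_const ρ
  have hpow : HasDerivAt (fun z : ℝ => (1 - z ^ 2) ^ (k + 1) / (2 * ((k : ℝ) + 1)))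
      (-(z * (1 - z ^ 2) ^ k)) z := by
    convert! ((((hasDerivAt_id z).pow 2).const_sub 1).pow (k + 1)).div_const
      (2 * ((k : ℝ) + 1)) using 1
    have : (k : ℝ) + 1 ≠ 0 := by positivity
    simp only [Nat.cast_add, Nat.cast_one, Pi.pow_apply, id_eq, add_tsub_cancel_right,
      Nat.cast_ofNat, Nat.add_one_sub_one, pow_one, mul_one, mul_neg]
    field_simp
  convert! hpow.mul hlin.sin using 1
  ring

lemma hasDerivAt_besselKernel (k : ℕ) (ρ : ℝ) :
    HasDerivAt (besselKernel k) (ρ * (-(1 / (2 * ((k : ℝ) + 1))) * besselKernel (k + 1) ρ)) ρ := by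
  have hparts := intervalIntegral.integral_eq_sub_of_hasDerivAt (a := 0) (b := 1)
    (fun z _ => hasDerivAt_one_sub_sq_pow_mul_sin k ρ z)
    (Continuous.intervalIntegrable (by fun_prop) _ _)
  rw [intervalIntegral.integral_add (Continuous.intervalIntegrable (by fun_prop) _ _)
    (Continuous.intervalIntegrable (by fun_prop) _ _), intervalIntegral.integral_const_mul,
    ← besselKernel] at hparts
  convert! hasDerivAt_besselKernel_integral k ρ using 1
  simp only [one_pow, sub_self, zero_pow k.succ_ne_zero, zero_div, zero_mul, mul_zero,
    Real.sin_zero] at hparts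
  simp only [mul_neg, neg_mul, intervalIntegral.integral_neg] at hparts ⊢
  linear_combination -hparts

section InnerProductSpace

variable {E : Type*} [NormedAddCommGroup E] [InnerProductSpace ℝ E]

lemma hasTemperateGrowth_besselKernel_norm (k : ℕ) :
    (fun x : E => besselKernel k ‖x‖).HasTemperateGrowth := by
  refine hasTemperateGrowth_of_hasFDerivAt_smul (f := fun k x => besselKernel k ‖x‖)
    (L := fun k => ⇑((-(1 / (2 * ((k : ℝ) + 1)))) • (innerSL ℝ : E →L[ℝ] E →L[ℝ] ℝ)))
    (fun k x => ?_) (fun k => ⟨0, 1, fun x => ?_⟩)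
    (fun k => ContinuousLinearMap.hasTemperateGrowth _) k
  · convert! hasFDerivAt_comp_norm_of_hasDerivAt_mul (hasDerivAt_besselKernel k) x using 1
    rw [smul_apply, smul_smul, mul_comm]
  · simpa using abs_besselKernel_le k ‖x‖

lemma hasTemperateGrowth_sinc_norm : (fun x : E => Real.sinc ‖x‖).HasTemperateGrowth := by
  simpa only [besselKernel_zero] using hasTemperateGrowth_besselKernel_norm (E := E) 0

lemma hasTemperateGrowth_cos_norm : (fun x : E => Real.cos ‖x‖).HasTemperateGrowth := by
  have hcos : ∀ ρ, HasDerivAt Real.cos (ρ * -Real.sinc ρ) ρ := fun ρ => by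
    convert! Real.hasDerivAt_cos ρ using 1
    rcases eq_or_ne ρ 0 with rfl | h
    · simp
    · rw [Real.sinc_of_ne_zero h]
      field_simp
  have hd := hasFDerivAt_comp_norm_of_hasDerivAt_mul (E := E) hcos
  refine Function.HasTemperateGrowth.of_fderiv (k := 0) (C := 1) ?_
    (fun x => (hd x).differentiableAt) (fun x => by simpa using Real.abs_cos_le_one _)
  rw [show fderiv ℝ (fun x : E => Real.cos ‖x‖) = fun x : E => (-Real.sinc ‖x‖) • innerSL ℝ x from
    funext fun x => (hd x).fderiv]
  exact hasTemperateGrowth_sinc_norm.neg.smul (innerSL ℝ : E →L[ℝ] E →L[ℝ] ℝ).hasTemperateGrowth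

lemma hasTemperateGrowth_comp_mul_norm {h : ℝ → ℝ} (heven : h.Even)
    (hh : (fun x : E => h ‖x‖).HasTemperateGrowth) (c : ℝ) :
    (fun x : E => h (c * ‖x‖)).HasTemperateGrowth := by
  convert! hh.comp (c • ContinuousLinearMap.id ℝ E).hasTemperateGrowth using 1
  ext x
  simp only [Function.comp_apply, smul_apply, ContinuousLinearMap.id_apply, norm_smul,
    Real.norm_eq_abs]
  rcases abs_choice c with hc | hc <;> rw [hc]
  rw [neg_mul, heven]

end InnerProductSpace

lemma hasTemperateGrowth_cosSymbol (t : ℝ) : (cosSymbol t).HasTemperateGrowth := by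
  have h := hasTemperateGrowth_comp_mul_norm Real.cos_neg (hasTemperateGrowth_cos_norm (E := E3))
    (t * (2 * Real.pi))
  simp only [mul_assoc t] at h
  exact Function.Complex.hasTemperateGrowth_ofReal.comp h

lemma hasTemperateGrowth_sinSymbol (t : ℝ) : (sinSymbol t).HasTemperateGrowth := by
  have h := hasTemperateGrowth_comp_mul_norm Real.sinc_neg (hasTemperateGrowth_sinc_norm (E := E3))
    (t * (2 * Real.pi))
  simp only [mul_assoc t] at h
  exact Function.Complex.hasTemperateGrowth_ofReal.comp
    ((Function.HasTemperateGrowth.const t).mul h)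

end Symbols

section Profile

/-- A smooth function on the line which vanishes outside `[α, β]`. -/
structure IsProfile (α β : ℝ) (ϕ : ℝ → ℝ) : Prop where
  smooth : ContDiff ℝ (⊤ : ℕ∞) ϕ
  eq_zero : ∀ r, r ∉ Set.Icc α β → ϕ r = 0

namespace IsProfile

variable {α β : ℝ} {ϕ ψ : ℝ → ℝ}

lemma mono (h : IsProfile α β ϕ) {α' β' : ℝ} (hα : α' ≤ α) (hβ : β ≤ β') : IsProfile α' β' ϕ :=
  ⟨h.smooth, fun r hr => h.eq_zero r fun hr' => hr ⟨hα.trans hr'.1, hr'.2.trans hβ⟩⟩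

lemma continuous (h : IsProfile α β ϕ) : Continuous ϕ := h.smooth.continuous

lemma hasDerivAt (h : IsProfile α β ϕ) (r : ℝ) : HasDerivAt ϕ (deriv ϕ r) r :=
  (h.smooth.differentiable (by simp) r).hasDerivAt

lemma hasCompactSupport (h : IsProfile α β ϕ) : HasCompactSupport ϕ :=
  HasCompactSupport.intro isCompact_Icc h.eq_zero

lemma integrable (h : IsProfile α β ϕ) : Integrable ϕ :=
  h.continuous.integrable_of_hasCompactSupport h.hasCompactSupport

lemma exists_bound (h : IsProfile α β ϕ) : ∃ M, ∀ r, |ϕ r| ≤ M :=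
  h.hasCompactSupport.exists_bound_of_continuous h.continuous

lemma eventuallyEq_zero (h : IsProfile α β ϕ) {r : ℝ} (hr : r ∉ Set.Icc α β) :
    ϕ =ᶠ[𝓝 r] 0 := by
  filter_upwards [isClosed_Icc.isOpen_compl.mem_nhds hr] with s hs using h.eq_zero s hs

lemma deriv (h : IsProfile α β ϕ) : IsProfile α β (deriv ϕ) := by
  refine ⟨(contDiff_infty_iff_deriv.1 h.smooth).2, fun r hr => ?_⟩
  rw [(h.eventuallyEq_zero hr).deriv_eq]
  simp

lemma add (h : IsProfile α β ϕ) (h' : IsProfile α β ψ) : IsProfile α β (fun r => ϕ r + ψ r) :=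
  ⟨h.smooth.add h'.smooth, fun r hr => by rw [h.eq_zero r hr, h'.eq_zero r hr, add_zero]⟩

lemma sub (h : IsProfile α β ϕ) (h' : IsProfile α β ψ) : IsProfile α β (fun r => ϕ r - ψ r) :=
  ⟨h.smooth.sub h'.smooth, fun r hr => by rw [h.eq_zero r hr, h'.eq_zero r hr, sub_zero]⟩

lemma const_mul (h : IsProfile α β ϕ) (c : ℝ) : IsProfile α β (fun r => c * ϕ r) :=
  ⟨contDiff_const.mul h.smooth, fun r hr => by rw [h.eq_zero r hr, mul_zero]⟩

lemma id_mul (h : IsProfile α β ϕ) : IsProfile α β (fun r => r * ϕ r) :=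
  ⟨contDiff_id.mul h.smooth, fun r hr => by rw [h.eq_zero r hr, mul_zero]⟩

lemma comp_sub (h : IsProfile α β ϕ) (s : ℝ) : IsProfile (α + s) (β + s) (fun r => ϕ (r - s)) :=
  ⟨h.smooth.comp (contDiff_id.sub contDiff_const), fun r hr => h.eq_zero _ fun hr' =>
    hr ⟨by linarith [hr'.1], by linarith [hr'.2]⟩⟩

lemma div_id (h : IsProfile α β ϕ) (hα : 0 < α) : IsProfile α β (fun r => ϕ r / r) := by
  refine ⟨contDiff_iff_contDiffAt.2 fun r => ?_, fun r hr => by rw [h.eq_zero r hr, zero_div]⟩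
  rcases eq_or_ne r 0 with rfl | hr
  · have h0 := h.eventuallyEq_zero (r := 0) fun h => hα.not_ge h.1
    refine (contDiffAt_const (c := (0 : ℝ))).congr_of_eventuallyEq ?_
    filter_upwards [h0] with s hs
    rw [hs, Pi.zero_apply, zero_div]
  · exact h.smooth.contDiffAt.div contDiffAt_id hr

lemma id_mul_nonneg (h : IsProfile α β ϕ) (hα : 0 < α) (hn : ∀ r, 0 ≤ ϕ r) (r : ℝ) :
    0 ≤ r * ϕ r := by
  by_cases hr : r ∈ Set.Icc α β
  · exact mul_nonneg (hα.le.trans hr.1) (hn r)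
  · rw [h.eq_zero r hr, mul_zero]

section CompNorm

lemma eq_zero_comp_norm {E : Type*} [SeminormedAddCommGroup E] (h : IsProfile α β ϕ) {x : E}
    (hx : x ∉ {y : E | α ≤ ‖y‖ ∧ ‖y‖ ≤ β}) : ϕ ‖x‖ = 0 :=
  h.eq_zero _ hx

lemma tsupport_comp_norm_subset {E : Type*} [SeminormedAddCommGroup E] (h : IsProfile α β ϕ) :
    tsupport (fun x : E => ϕ ‖x‖) ⊆ {x | α ≤ ‖x‖ ∧ ‖x‖ ≤ β} := by
  refine closure_minimal (fun x hx => ?_) ?_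
  · by_contra hx'
    exact hx (h.eq_zero_comp_norm hx')
  · exact (isClosed_le continuous_const continuous_norm).inter
      (isClosed_le continuous_norm continuous_const)

lemma hasCompactSupport_comp_norm {E : Type*} [SeminormedAddCommGroup E] [ProperSpace E]
    (h : IsProfile α β ϕ) : HasCompactSupport (fun x : E => ϕ ‖x‖) :=
  HasCompactSupport.intro (isCompact_closedBall (0 : E) β) fun x hx => h.eq_zero _ fun h' =>
    hx (by simpa using h'.2)

lemma contDiff_comp_norm {E : Type*} [NormedAddCommGroup E] [InnerProductSpace ℝ E]
    (h : IsProfile α β ϕ) (hα : 0 < α) : ContDiff ℝ (⊤ : ℕ∞) (fun x : E => ϕ ‖x‖) := by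
  refine contDiff_iff_contDiffAt.2 fun x => ?_
  rcases eq_or_ne x 0 with rfl | hx
  · have h0 := h.eventuallyEq_zero (r := ‖(0 : E)‖) fun h => hα.not_ge (by simpa using h.1)
    exact (contDiffAt_const (c := (0 : ℝ))).congr_of_eventuallyEq
      ((continuous_norm.tendsto (0 : E)).eventually h0)
  · exact h.smooth.contDiffAt.comp x (contDiffAt_norm ℝ hx)

end CompNorm

end IsProfile

end Profile

section Window

/-- The mean of the two translates of `ϕ` by `± b`; this is the action of `cos(b√-Δ)` on radial
profiles. -/
def shiftMean (ϕ : ℝ → ℝ) (b r : ℝ) : ℝ := (1 / 2) * (ϕ (r + b) + ϕ (r - b))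

/-- The mean of `ϕ` over `[r - b, r + b]`, times `b`; this is the action of `sin(b√-Δ)/√-Δ` on
radial profiles. -/
def halfWindow (ϕ : ℝ → ℝ) (b r : ℝ) : ℝ := (1 / 2) * ∫ s in (r - b)..(r + b), ϕ s

variable {α β : ℝ} {ϕ : ℝ → ℝ}

lemma shiftMean_zero (ϕ : ℝ → ℝ) : shiftMean ϕ 0 = ϕ := by
  ext r
  simp only [shiftMean, add_zero, sub_zero]
  ring

lemma shiftMean_neg (ϕ : ℝ → ℝ) (b : ℝ) : shiftMean ϕ (-b) = shiftMean ϕ b := by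
  ext r
  simp only [shiftMean, sub_neg_eq_add, ← sub_eq_add_neg, add_comm]

lemma halfWindow_zero (ϕ : ℝ → ℝ) : halfWindow ϕ 0 = 0 := by
  ext r
  simp [halfWindow]

lemma halfWindow_neg (ϕ : ℝ → ℝ) (b r : ℝ) : halfWindow ϕ (-b) r = -halfWindow ϕ b r := by
  rw [halfWindow, halfWindow, intervalIntegral.integral_symm]
  simp only [sub_neg_eq_add, ← sub_eq_add_neg]
  ring

lemma halfWindow_nonneg (h : ∀ r, 0 ≤ ϕ r) {b : ℝ} (hb : 0 ≤ b) (r : ℝ) : 0 ≤ halfWindow ϕ b r :=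
  mul_nonneg (by norm_num) (intervalIntegral.integral_nonneg (by linarith) fun s _ => h s)

lemma abs_shiftMean_le {M : ℝ} (hM : ∀ r, |ϕ r| ≤ M) (b r : ℝ) : |shiftMean ϕ b r| ≤ M := by
  have h := (abs_add_le (ϕ (r + b)) (ϕ (r - b))).trans (add_le_add (hM _) (hM _))
  rw [shiftMean, abs_mul, abs_of_pos one_half_pos]
  linarith

lemma hasDerivAt_integral_of_continuous (h : Continuous ϕ) (r : ℝ) :
    HasDerivAt (fun r => ∫ s in (0 : ℝ)..r, ϕ s) (ϕ r) r :=
  intervalIntegral.integral_hasDerivAt_right (h.intervalIntegrable _ _)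
    h.stronglyMeasurable.stronglyMeasurableAtFilter h.continuousAt

lemma halfWindow_eq (h : Continuous ϕ) (b r : ℝ) : halfWindow ϕ b r =
    (1 / 2) * ((∫ s in (0 : ℝ)..(r + b), ϕ s) - ∫ s in (0 : ℝ)..(r - b), ϕ s) := by
  rw [halfWindow, intervalIntegral.integral_interval_sub_left] <;>
  exact h.intervalIntegrable _ _

lemma continuous_halfWindow_uncurry (h : Continuous ϕ) :
    Continuous fun z : ℝ × ℝ => halfWindow ϕ z.1 z.2 := by
  have : Continuous fun r => ∫ s in (0 : ℝ)..r, ϕ s :=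
    continuous_iff_continuousAt.2 fun r => (hasDerivAt_integral_of_continuous h r).continuousAt
  simp only [halfWindow_eq h]
  fun_prop

lemma hasDerivAt_halfWindow_left (h : Continuous ϕ) (b r : ℝ) :
    HasDerivAt (fun b => halfWindow ϕ b r) (shiftMean ϕ b r) b := by
  simp only [halfWindow_eq h]
  have hadd := (hasDerivAt_integral_of_continuous h (r + b)).comp b ((hasDerivAt_id b).const_add r)
  have hsub := (hasDerivAt_integral_of_continuous h (r - b)).comp b ((hasDerivAt_id b).const_sub r)
  convert! (hadd.sub hsub).const_mul (1 / 2) using 1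
  rw [shiftMean]
  ring

lemma halfWindow_deriv (h : ContDiff ℝ 1 ϕ) (b r : ℝ) :
    halfWindow (deriv ϕ) b r = (1 / 2) * (ϕ (r + b) - ϕ (r - b)) := by
  rw [halfWindow, intervalIntegral.integral_deriv_eq_sub fun s _ => h.differentiable one_ne_zero s]
  exact (h.continuous_deriv le_rfl).intervalIntegrable _ _

lemma hasDerivAt_halfWindow (h : ContDiff ℝ 1 ϕ) (b r : ℝ) :
    HasDerivAt (halfWindow ϕ b) (halfWindow (deriv ϕ) b r) r := by
  rw [halfWindow_deriv h,
    show halfWindow ϕ b = _ from funext fun r => halfWindow_eq h.continuous b r]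
  exact ((hasDerivAt_integral_of_continuous h.continuous (r + b)).comp_add_const r b |>.sub
    ((hasDerivAt_integral_of_continuous h.continuous (r - b)).comp_sub_const r b)).const_mul (1 / 2)

lemma hasDerivAt_shiftMean_left (h : ContDiff ℝ 2 ϕ) (b r : ℝ) :
    HasDerivAt (fun b => shiftMean ϕ b r) (halfWindow (deriv (deriv ϕ)) b r) b := by
  have hd : ContDiff ℝ 1 (deriv ϕ) := h.deriv'
  have hϕ : ∀ s, HasDerivAt ϕ (deriv ϕ s) s := fun s =>
    (h.differentiable (by simp) s).hasDerivAt
  have hadd := (hϕ (r + b)).comp b ((hasDerivAt_id b).const_add r)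
  have hsub := (hϕ (r - b)).comp b ((hasDerivAt_id b).const_sub r)
  convert! (hadd.add hsub).const_mul (1 / 2) using 1
  rw [halfWindow_deriv hd]
  ring

namespace IsProfile

lemma contDiff (h : IsProfile α β ϕ) (n : ℕ) : ContDiff ℝ n ϕ :=
  h.smooth.of_le (mod_cast le_top)

lemma deriv_deriv_halfWindow (h : IsProfile α β ϕ) (b : ℝ) :
    _root_.deriv (_root_.deriv (halfWindow ϕ b)) =
      halfWindow (_root_.deriv (_root_.deriv ϕ)) b := by
  have hderiv : ∀ {ψ : ℝ → ℝ}, IsProfile α β ψ →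
      _root_.deriv (halfWindow ψ b) = halfWindow (_root_.deriv ψ) b := fun hψ =>
    funext fun r => (hasDerivAt_halfWindow (hψ.contDiff 1) b r).deriv
  rw [hderiv h, hderiv h.deriv]

lemma shiftMean (h : IsProfile α β ϕ) (b : ℝ) :
    IsProfile (α - |b|) (β + |b|) (shiftMean ϕ b) := by
  have hsub := (h.comp_sub b).mono (α' := α - |b|) (β' := β + |b|)
    (by linarith [neg_abs_le b]) (by linarith [le_abs_self b])
  have hadd := (h.comp_sub (-b)).mono (α' := α - |b|) (β' := β + |b|)
    (by linarith [le_abs_self b]) (by linarith [neg_abs_le b])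
  simp only [sub_neg_eq_add] at hadd
  exact (hadd.add hsub).const_mul _

lemma halfWindow (h : IsProfile α β ϕ) (b : ℝ) :
    IsProfile (α - |b|) (β + |b|) (halfWindow ϕ b) := by
  have hd := hasDerivAt_halfWindow (h.contDiff 1) b
  refine ⟨contDiff_infty_iff_deriv.2 ⟨fun r => (hd r).differentiableAt, ?_⟩, fun r hr => ?_⟩
  · rw [funext fun r => (hd r).deriv, funext fun r => halfWindow_deriv (h.contDiff 1) b r]
    exact contDiff_const.mul ((h.smooth.comp (contDiff_id.add contDiff_const)).sub
      (h.smooth.comp (contDiff_id.sub contDiff_const)))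
  · have hzero : ∀ s ∈ Set.uIcc (r - b) (r + b), ϕ s = 0 := fun s hs => by
      refine h.eq_zero s fun hs' => hr ?_
      have hsr : |s - r| ≤ |b| := by
        rw [← neg_add_eq_sub, Set.mem_uIcc] at hs
        rcases abs_cases b with hb | hb <;> rw [abs_le] <;> rcases hs with hs | hs <;>
          constructor <;> linarith
      exact ⟨by linarith [hs'.1, (abs_le.1 hsr).2], by linarith [hs'.2, (abs_le.1 hsr).1]⟩
    rw [RadialWave.halfWindow, intervalIntegral.integral_congr hzero,
      intervalIntegral.integral_zero, mul_zero]

end IsProfile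

end Window

section RadialPairing

lemma integrable_smul_of_locallyIntegrableOn {X G : Type*} [TopologicalSpace X] [T2Space X]
    [MeasurableSpace X] [OpensMeasurableSpace X] {μ : Measure X} [NormedAddCommGroup G]
    [NormedSpace ℝ G] {g : X → G} {Ω : Set X} (hg : LocallyIntegrableOn g Ω μ) {φ : X → ℝ}
    (hφ : Continuous φ) (hc : HasCompactSupport φ) (hs : tsupport φ ⊆ Ω) :
    Integrable (fun x => φ x • g x) μ := by
  have hi : IntegrableOn (fun x => φ x • g x) (tsupport φ) μ :=
    (hg.integrableOn_compact_subset hs hc).continuousOn_smul hφ.continuousOn hc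
  rwa [integrableOn_iff_integrable_of_support_subset] at hi
  exact (Function.support_smul_subset_left _ _).trans (subset_tsupport _)

variable {G : Type*} [NormedAddCommGroup G] [NormedSpace ℝ G]

/-- The pairing of a function on `ℝ³` with the test function `ϕ(|x|)/|x|`. Dividing by `|x|` turns
the radial Laplacian of `ℝ³` into the second derivative on the half-line. -/
def radialPair (V : E3 → G) (ϕ : ℝ → ℝ) : G := ∫ x, (ϕ ‖x‖ / ‖x‖) • V x

variable {α β ρ : ℝ} {ϕ ψ : ℝ → ℝ} {V V' L : E3 → G}

lemma IsProfile.integrable_radialPair (h : IsProfile α β ϕ) (hρ : 0 ≤ ρ) (hα : ρ < α)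
    (hV : LocallyIntegrableOn V {x | ρ < ‖x‖}) : Integrable fun x => (ϕ ‖x‖ / ‖x‖) • V x := by
  have hdiv := h.div_id (hρ.trans_lt hα)
  exact integrable_smul_of_locallyIntegrableOn hV
    (hdiv.contDiff_comp_norm (hρ.trans_lt hα)).continuous hdiv.hasCompactSupport_comp_norm
    (hdiv.tsupport_comp_norm_subset.trans fun x hx => hα.trans_le hx.1)

lemma radialPair_add_right (hρ : 0 ≤ ρ) (hα : ρ < α) (hV : LocallyIntegrableOn V {x | ρ < ‖x‖})
    (hϕ : IsProfile α β ϕ) (hψ : IsProfile α β ψ) :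
    radialPair V (fun r => ϕ r + ψ r) = radialPair V ϕ + radialPair V ψ := by
  simp only [radialPair, add_div, add_smul]
  exact integral_add (hϕ.integrable_radialPair hρ hα hV) (hψ.integrable_radialPair hρ hα hV)

lemma radialPair_const_mul_right (c : ℝ) (V : E3 → G) (ϕ : ℝ → ℝ) :
    radialPair V (fun r => c * ϕ r) = c • radialPair V ϕ := by
  simp only [radialPair, mul_div_assoc, mul_smul, integral_smul]

lemma radialPair_const_mul_left (c : ℝ) (V : E3 → ℝ) (ϕ : ℝ → ℝ) :
    radialPair (fun x => c * V x) ϕ = c * radialPair V ϕ := by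
  simp only [radialPair, smul_eq_mul, mul_left_comm _ c, integral_const_mul]

lemma radialPair_add_left (hρ : 0 ≤ ρ) (hα : ρ < α) (hV : LocallyIntegrableOn V {x | ρ < ‖x‖})
    (hV' : LocallyIntegrableOn V' {x | ρ < ‖x‖}) (hϕ : IsProfile α β ϕ) :
    radialPair (fun x => V x + V' x) ϕ = radialPair V ϕ + radialPair V' ϕ := by
  simp only [radialPair, smul_add]
  exact integral_add (hϕ.integrable_radialPair hρ hα hV) (hϕ.integrable_radialPair hρ hα hV')

lemma radialPair_sub_left (hρ : 0 ≤ ρ) (hα : ρ < α) (hV : LocallyIntegrableOn V {x | ρ < ‖x‖})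
    (hV' : LocallyIntegrableOn V' {x | ρ < ‖x‖}) (hϕ : IsProfile α β ϕ) :
    radialPair (fun x => V x - V' x) ϕ = radialPair V ϕ - radialPair V' ϕ := by
  simp only [radialPair, smul_sub]
  exact integral_sub (hϕ.integrable_radialPair hρ hα hV) (hϕ.integrable_radialPair hρ hα hV')

lemma hasDerivAt_radialPair {P P' : ℝ → ℝ → ℝ} {S : Set ℝ} {s₀ M : ℝ} (hρ : 0 ≤ ρ) (hα : ρ < α)
    (hV : LocallyIntegrableOn V {x | ρ < ‖x‖}) (hS : S ∈ 𝓝 s₀)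
    (hP : ∀ s ∈ S, IsProfile α β (P s)) (hP' : ∀ s ∈ S, IsProfile α β (P' s))
    (hM : ∀ s ∈ S, ∀ r, |P' s r| ≤ M)
    (hd : ∀ s ∈ S, ∀ r, HasDerivAt (fun s => P s r) (P' s r) s) :
    HasDerivAt (fun s => radialPair V (P s)) (radialPair V (P' s₀)) s₀ := by
  set K : Set E3 := {x | α ≤ ‖x‖ ∧ ‖x‖ ≤ β}
  have hα0 : 0 < α := hρ.trans_lt hα
  have hKclosed : IsClosed K := (isClosed_le continuous_const continuous_norm).inter
    (isClosed_le continuous_norm continuous_const)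
  have hKcompact : IsCompact K := (isCompact_closedBall (0 : E3) β).of_isClosed_subset hKclosed
    fun x hx => by simpa using hx.2
  have hs₀ : s₀ ∈ S := mem_of_mem_nhds hS
  have hbound : ∀ s ∈ S, ∀ x,
      ‖(P' s ‖x‖ / ‖x‖) • V x‖ ≤ K.indicator (fun x => M / α * ‖V x‖) x := by
    intro s hs x
    by_cases hx : x ∈ K
    · rw [Set.indicator_of_mem hx, norm_smul, Real.norm_eq_abs, abs_div, abs_norm]
      gcongr
      exacts [(abs_nonneg _).trans (hM s hs 0), hM s hs _, hx.1]
    · rw [Set.indicator_of_notMem hx, (hP' s hs).eq_zero_comp_norm hx, zero_div, zero_smul,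
        norm_zero]
  refine (hasDerivAt_integral_of_dominated_loc_of_deriv_le hS ?_
    ((hP s₀ hs₀).integrable_radialPair hρ hα hV)
    ((hP' s₀ hs₀).integrable_radialPair hρ hα hV).aestronglyMeasurable
    (Eventually.of_forall fun x s hs => hbound s hs x) ?_
    (Eventually.of_forall fun x s hs => ((hd s hs ‖x‖).div_const _).smul_const (V x))).2
  · filter_upwards [hS] with s hs
    exact ((hP s hs).integrable_radialPair hρ hα hV).aestronglyMeasurable
  · rw [integrable_indicator_iff hKclosed.measurableSet]
    exact (hV.integrableOn_compact_subset (fun x hx => hα.trans_le hx.1)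
      hKcompact).norm.const_mul _

lemma exists_mem_nhds_abs_lt {b c : ℝ} (hb : |b| < c) :
    ∃ d < c, {b' : ℝ | |b'| ≤ d} ∈ 𝓝 b := by
  obtain ⟨d, hbd, hdc⟩ := exists_between hb
  refine ⟨d, hdc, ?_⟩
  filter_upwards [(isOpen_lt continuous_abs continuous_const).mem_nhds hbd] with b' hb'
  exact le_of_lt hb'

lemma hasDerivAt_radialPair_halfWindow (hρ : 0 ≤ ρ) (hV : LocallyIntegrableOn V {x | ρ < ‖x‖})
    (h : IsProfile α β ϕ) {b : ℝ} (hb : ρ < α - |b|) :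
    HasDerivAt (fun b => radialPair V (halfWindow ϕ b)) (radialPair V (shiftMean ϕ b)) b := by
  obtain ⟨d, hd, hS⟩ := exists_mem_nhds_abs_lt (lt_sub_comm.1 hb)
  obtain ⟨M, hM⟩ := h.exists_bound
  exact hasDerivAt_radialPair (α := α - d) (β := β + d) (P := halfWindow ϕ) (P' := shiftMean ϕ) hρ
    (by linarith) hV hS
    (fun b' hb' => (h.halfWindow b').mono (sub_le_sub_left hb' _) (by gcongr; exact hb'))
    (fun b' hb' => (h.shiftMean b').mono (sub_le_sub_left hb' _) (by gcongr; exact hb'))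
    (fun b' _ => abs_shiftMean_le hM b') fun b' _ => hasDerivAt_halfWindow_left h.continuous b'

lemma hasDerivAt_radialPair_shiftMean (hρ : 0 ≤ ρ) (hV : LocallyIntegrableOn V {x | ρ < ‖x‖})
    (h : IsProfile α β ϕ) {b : ℝ} (hb : ρ < α - |b|) :
    HasDerivAt (fun b => radialPair V (shiftMean ϕ b))
      (radialPair V (halfWindow (deriv (deriv ϕ)) b)) b := by
  obtain ⟨d, hd, hS⟩ := exists_mem_nhds_abs_lt (lt_sub_comm.1 hb)
  obtain ⟨M, hM⟩ := h.deriv.exists_bound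
  refine hasDerivAt_radialPair (α := α - d) (β := β + d) (M := M) (P := shiftMean ϕ)
    (P' := halfWindow (deriv (deriv ϕ))) hρ (by linarith) hV hS
    (fun b' hb' => (h.shiftMean b').mono (sub_le_sub_left hb' _) (by gcongr; exact hb'))
    (fun b' hb' => (h.deriv.deriv.halfWindow b').mono (sub_le_sub_left hb' _)
      (by gcongr; exact hb'))
    (fun b' _ r => ?_) fun b' _ => hasDerivAt_shiftMean_left (h.contDiff 2) b'
  rw [halfWindow_deriv (h.deriv.contDiff 1), abs_mul, abs_of_pos one_half_pos]
  linarith [abs_sub (deriv ϕ (r + b')) (deriv ϕ (r - b')), hM (r + b'), hM (r - b')]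

/-- `L` is the Laplacian of `V` on `{|x| > ρ}`, tested against radial functions `χ(|x|)/|x|`. -/
structure HasRadialLaplacian (ρ : ℝ) (V L : E3 → G) : Prop where
  locallyIntegrableOn : LocallyIntegrableOn V {x | ρ < ‖x‖}
  locallyIntegrableOn_laplacian : LocallyIntegrableOn L {x | ρ < ‖x‖}
  radialPair_deriv_deriv : ∀ {α β : ℝ} {χ : ℝ → ℝ}, ρ < α → IsProfile α β χ →
    radialPair V (deriv (deriv χ)) = radialPair L χ

lemma HasRadialLaplacian.hasDerivAt_radialPair_shiftMean (hV : HasRadialLaplacian ρ V L)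
    (hρ : 0 ≤ ρ) (h : IsProfile α β ϕ) {b : ℝ} (hb : ρ < α - |b|) :
    HasDerivAt (fun b => radialPair V (shiftMean ϕ b)) (radialPair L (halfWindow ϕ b)) b := by
  rw [← hV.radialPair_deriv_deriv hb (h.halfWindow b), h.deriv_deriv_halfWindow]
  exact RadialWave.hasDerivAt_radialPair_shiftMean hρ hV.locallyIntegrableOn h hb

lemma abs_le_abs_of_mem_uIcc {b s : ℝ} (hb : b ∈ Set.uIcc 0 s) : |b| ≤ |s| := by
  simpa using Set.abs_sub_left_of_mem_uIcc hb

lemma intervalIntegrable_radialPair_halfWindow (hρ : 0 ≤ ρ)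
    (hV : LocallyIntegrableOn V {x | ρ < ‖x‖}) (h : IsProfile α β ϕ) {s : ℝ} (hs : ρ < α - |s|) :
    IntervalIntegrable (fun b => radialPair V (halfWindow ϕ b)) volume 0 s :=
  ContinuousOn.intervalIntegrable fun b hb => (hasDerivAt_radialPair_halfWindow hρ hV h
    (by linarith [abs_le_abs_of_mem_uIcc hb])).continuousAt.continuousWithinAt

lemma HasRadialLaplacian.integral_radialPair_halfWindow [CompleteSpace G]
    (hV : HasRadialLaplacian ρ V L) (hρ : 0 ≤ ρ) (h : IsProfile α β ϕ) {s : ℝ}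
    (hs : ρ < α - |s|) :
    ∫ b in (0 : ℝ)..s, radialPair L (halfWindow ϕ b) =
      radialPair V (shiftMean ϕ s) - radialPair V ϕ := by
  rw [intervalIntegral.integral_eq_sub_of_hasDerivAt (fun b hb =>
    hV.hasDerivAt_radialPair_shiftMean hρ h (by linarith [abs_le_abs_of_mem_uIcc hb]))
    (intervalIntegrable_radialPair_halfWindow hρ hV.locallyIntegrableOn_laplacian h hs),
    shiftMean_zero]

end RadialPairing

section Laplacian

variable {E : Type*} [NormedAddCommGroup E] [InnerProductSpace ℝ E] [FiniteDimensional ℝ E]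

lemma laplacian_comp_norm {g g₁ : ℝ → ℝ} {g₂ : ℝ} {x : E} (hx : x ≠ 0)
    (hg : ∀ᶠ r in 𝓝 ‖x‖, HasDerivAt g (g₁ r) r) (hg₁ : HasDerivAt g₁ g₂ ‖x‖) :
    Δ (fun y : E => g ‖y‖) x = g₂ + (Module.finrank ℝ E - 1) * (g₁ ‖x‖ / ‖x‖) := by
  have hx0 : ‖x‖ ≠ 0 := norm_ne_zero_iff.2 hx
  have hfderiv : fderiv ℝ (fun y : E => g ‖y‖) =ᶠ[𝓝 x] fun y => (g₁ ‖y‖ / ‖y‖) • innerSL ℝ y := by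
    filter_upwards [(continuous_norm.tendsto x).eventually hg, isOpen_ne.mem_nhds hx] with y hy hy0
    exact (hasFDerivAt_comp_norm hy0 hy).fderiv
  have hsecond := (hasFDerivAt_comp_norm hx (hg₁.div (hasDerivAt_id _) hx0)).smul
    ((innerSL ℝ : E →L[ℝ] E →L[ℝ] ℝ).hasFDerivAt (x := x))
  set e := stdOrthonormalBasis ℝ E
  have hterm : ∀ i, iteratedFDeriv ℝ 2 (fun y : E => g ‖y‖) x ![e i, e i] = g₁ ‖x‖ / ‖x‖ +
      (g₂ / ‖x‖ - g₁ ‖x‖ / ‖x‖ ^ 2) / ‖x‖ * ‖inner ℝ x (e i)‖ ^ 2 := by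
    intro i
    rw [iteratedFDeriv_two_apply, (hsecond.congr_of_eventuallyEq hfderiv).fderiv]
    have hinner : ∀ y z : E, innerSL ℝ y z = inner ℝ y z := fun _ _ => rfl
    simp only [id_eq, Pi.div_apply, mul_one, Matrix.cons_val_zero, Matrix.cons_val_one, hinner,
      add_apply, smul_apply, ContinuousLinearMap.smulRight_apply, smul_eq_mul, Real.norm_eq_abs,
      sq_abs, real_inner_self_eq_norm_sq, e.norm_eq_one]
    field_simp
  rw [InnerProductSpace.laplacian_eq_iteratedFDeriv_orthonormalBasis _ e]
  simp only
  rw [Finset.sum_congr rfl fun i _ => hterm i, Finset.sum_add_distrib, ← Finset.mul_sum,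
    e.sum_sq_norm_inner_left]
  simp only [Finset.sum_const, Finset.card_univ, Fintype.card_fin, nsmul_eq_mul]
  field_simp
  ring

end Laplacian

lemma laplacian_comp_norm_div_norm {v v₁ : ℝ → ℝ} {v₂ : ℝ} {x : E3} (hx : x ≠ 0)
    (hv : ∀ᶠ r in 𝓝 ‖x‖, HasDerivAt v (v₁ r) r) (hv₁ : HasDerivAt v₁ v₂ ‖x‖) :
    Δ (fun y : E3 => v ‖y‖ / ‖y‖) x = v₂ / ‖x‖ := by
  have hx0 : ‖x‖ ≠ 0 := norm_ne_zero_iff.2 hx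
  have hg : ∀ᶠ r in 𝓝 ‖x‖, HasDerivAt (fun r => v r / r) (v₁ r / r - v r / r ^ 2) r := by
    filter_upwards [hv, isOpen_ne.mem_nhds hx0] with r hr hr0
    convert! hr.div (hasDerivAt_id r) hr0 using 1
    rw [id, mul_one]
    field_simp
  have hg₁ := (hv₁.div (hasDerivAt_id _) hx0).sub
    (hv.self_of_nhds.div ((hasDerivAt_id _).pow 2) (pow_ne_zero 2 hx0))
  refine (laplacian_comp_norm hx hg hg₁).trans ?_
  simp only [id_eq, Pi.pow_apply, finrank_euclideanSpace, Fintype.card_fin]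
  field_simp
  push_cast
  ring

section RadialTest

open Classical in
/-- The Schwartz function `x ↦ ϕ(|x|)/|x|`, with the junk value `0` unless it is smooth and
compactly supported, as it is for a profile `ϕ` supported away from the origin. -/
def radialTest (ϕ : ℝ → ℝ) : 𝓢(E3, ℂ) :=
  if h : HasCompactSupport (fun x : E3 => ((ϕ ‖x‖ / ‖x‖ : ℝ) : ℂ)) ∧
    ContDiff ℝ (⊤ : ℕ∞) (fun x : E3 => ((ϕ ‖x‖ / ‖x‖ : ℝ) : ℂ)) then h.1.toSchwartzMap h.2 else 0

variable {α β : ℝ} {ϕ ψ : ℝ → ℝ}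

lemma radialTest_apply (h : IsProfile α β ϕ) (hα : 0 < α) (x : E3) :
    radialTest ϕ x = ((ϕ ‖x‖ / ‖x‖ : ℝ) : ℂ) := by
  have hdiv := h.div_id hα
  rw [radialTest, dif_pos ⟨hdiv.hasCompactSupport_comp_norm.comp_left (g := Complex.ofReal)
    Complex.ofReal_zero, Complex.ofRealCLM.contDiff.comp (hdiv.contDiff_comp_norm hα)⟩]
  rfl

lemma integral_radialTest_mul (h : IsProfile α β ϕ) (hα : 0 < α) (f : E3 → ℂ) :
    ∫ x, radialTest ϕ x * f x = radialPair f ϕ := by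
  simp only [radialTest_apply h hα, radialPair, Complex.real_smul]

lemma fourier_radialTest (h : IsProfile α β ϕ) (hα : 0 < α) (ξ : E3) :
    𝓕 (radialTest ϕ) ξ = radialPair (fun x => (Real.fourierChar (-inner ℝ x ξ) : ℂ)) ϕ := by
  rw [SchwartzMap.fourier_coe, Real.fourier_eq, ← integral_radialTest_mul h hα]
  simp only [Circle.smul_def, smul_eq_mul, mul_comm]

lemma laplacian_radialTest (h : IsProfile α β ϕ) (hα : 0 < α) :
    Δ (radialTest ϕ) = radialTest (deriv (deriv ϕ)) := by
  ext x
  have hfun : (radialTest ϕ : E3 → ℂ) = Complex.ofRealCLM ∘ fun x : E3 => ϕ ‖x‖ / ‖x‖ :=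
    funext fun x => radialTest_apply h hα x
  have hsmooth : ContDiff ℝ 2 fun x : E3 => ϕ ‖x‖ / ‖x‖ :=
    ((h.div_id hα).contDiff_comp_norm hα).of_le (WithTop.coe_le_coe.2 le_top)
  rw [SchwartzMap.laplacian_apply, radialTest_apply h.deriv.deriv hα, hfun,
    hsmooth.contDiffAt.laplacian_CLM_comp_left, Function.comp_apply, Complex.ofRealCLM_apply]
  congr 1
  rcases eq_or_ne x 0 with rfl | hx
  · have hzero : (fun x : E3 => ϕ ‖x‖ / ‖x‖) =ᶠ[𝓝 0] fun _ => (0 : ℝ) := by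
      have hϕ := h.eventuallyEq_zero (r := ‖(0 : E3)‖) fun h => absurd h.1 (by simpa using hα)
      filter_upwards [(continuous_norm.tendsto (0 : E3)).eventually hϕ] with y hy
      rw [hy, Pi.zero_apply, zero_div]
    rw [(InnerProductSpace.laplacian_congr_nhds hzero).eq_of_nhds]
    simp
  · exact laplacian_comp_norm_div_norm hx (Eventually.of_forall h.hasDerivAt) (h.deriv.hasDerivAt _)

lemma fourier_radialTest_deriv_deriv (h : IsProfile α β ϕ) (hα : 0 < α) (ξ : E3) :
    𝓕 (radialTest (deriv (deriv ϕ))) ξ = -(2 * Real.pi * ‖ξ‖ : ℝ) ^ 2 * 𝓕 (radialTest ϕ) ξ := by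
  have hgrowth : (fun x : E3 => ‖x‖ ^ 2).HasTemperateGrowth := by fun_prop
  rw [← laplacian_radialTest h hα, SchwartzMap.laplacian_eq_fourierMultiplierCLM,
    SchwartzMap.fourierMultiplierCLM_apply, FourierTransform.fourier_smul,
    FourierTransform.fourier_fourierInv_eq]
  simp only [smul_apply, SchwartzMap.smulLeftCLM_apply_apply hgrowth, Complex.real_smul]
  push_cast
  ring

lemma hasRadialLaplacian_fourierChar (ξ : E3) :
    HasRadialLaplacian 0 (fun x : E3 => (Real.fourierChar (-inner ℝ x ξ) : ℂ))
      fun x => (-(2 * Real.pi * ‖ξ‖) ^ 2 : ℝ) • (Real.fourierChar (-inner ℝ x ξ) : ℂ) where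
  locallyIntegrableOn := (Continuous.locallyIntegrable (by fun_prop)).locallyIntegrableOn _
  locallyIntegrableOn_laplacian :=
    (Continuous.locallyIntegrable (by fun_prop)).locallyIntegrableOn _
  radialPair_deriv_deriv hα h := by
    rw [← fourier_radialTest h.deriv.deriv hα, fourier_radialTest_deriv_deriv h hα,
      fourier_radialTest h hα, radialPair, radialPair, ← integral_const_mul]
    congr 1 with x
    simp only [Complex.real_smul]
    push_cast
    ring

end RadialTest

section Propagator

lemma mul_mul_sinc (k b : ℝ) : k * (b * Real.sinc (b * k)) = Real.sin (b * k) := by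
  rcases eq_or_ne (b * k) 0 with h | h
  · rw [h, Real.sinc_zero, Real.sin_zero, mul_one, mul_comm, h]
  · rw [Real.sinc_of_ne_zero h]
    field_simp [left_ne_zero_of_mul h, right_ne_zero_of_mul h]

lemma hasDerivAt_mul_sinc (k b : ℝ) :
    HasDerivAt (fun b => b * Real.sinc (b * k)) (Real.cos (b * k)) b := by
  rcases eq_or_ne k 0 with rfl | hk
  · simpa only [mul_zero, Real.sinc_zero, mul_one, Real.cos_zero] using hasDerivAt_id' b
  · have hsin : (fun b => b * Real.sinc (b * k)) = fun b => Real.sin (b * k) / k := by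
      ext b
      rw [← mul_mul_sinc, mul_div_cancel_left₀ _ hk]
    rw [hsin]
    convert! ((hasDerivAt_mul_const (x := b) k).sin).div_const k using 1
    field_simp

lemma eq_cos_smul_add_sinc_smul {G : Type*} [NormedAddCommGroup G] [NormedSpace ℝ G] {k c : ℝ}
    {z y : ℝ → G} (hz : ∀ b, |b| < c → HasDerivAt z (y b) b)
    (hy : ∀ b, |b| < c → HasDerivAt y (-(k ^ 2) • z b) b) {b : ℝ} (hb : |b| < c) :
    z b = Real.cos (b * k) • z 0 + (b * Real.sinc (b * k)) • y 0 := by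
  set h : ℝ → G := fun s =>
    Real.cos ((b - s) * k) • z s + ((b - s) * Real.sinc ((b - s) * k)) • y s with hh
  have hderiv : ∀ s ∈ Set.Ioo (-c) c, HasDerivAt h 0 s := by
    intro s hs
    have hsub : HasDerivAt (fun s => b - s) (-1) s := (hasDerivAt_id s).const_sub b
    have hcos := ((hsub.mul_const k).cos).smul (hz s (abs_lt.2 hs))
    have hsin := ((hasDerivAt_mul_sinc k (b - s)).comp s hsub).smul (hy s (abs_lt.2 hs))
    convert! hcos.add hsin using 1
    simp only [← mul_mul_sinc, Function.comp_apply]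
    module
  have hconst := isOpen_Ioo.is_const_of_deriv_eq_zero isPreconnected_Ioo
    (fun s hs => (hderiv s hs).differentiableAt.differentiableWithinAt)
    (fun s hs => (hderiv s hs).deriv) (abs_lt.1 hb)
    (abs_lt.1 (show |0| < c by rw [abs_zero]; exact (abs_nonneg b).trans_lt hb))
  simpa only [hh, sub_self, sub_zero, zero_mul, Real.cos_zero, one_smul, zero_smul, add_zero]
    using hconst

variable {α β : ℝ} {ϕ : ℝ → ℝ}

lemma HasRadialLaplacian.radialPair_of_eigenfunction {G : Type*} [NormedAddCommGroup G]
    [NormedSpace ℝ G] {ρ k : ℝ} {V : E3 → G}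
    (hV : HasRadialLaplacian ρ V fun x => -(k ^ 2) • V x) (hρ : 0 ≤ ρ) (h : IsProfile α β ϕ)
    {b : ℝ} (hb : ρ < α - |b|) :
    radialPair V (shiftMean ϕ b) = Real.cos (b * k) • radialPair V ϕ ∧
      radialPair V (halfWindow ϕ b) = (b * Real.sinc (b * k)) • radialPair V ϕ := by
  have hz : ∀ b, |b| < α - ρ → HasDerivAt (fun b => radialPair V (halfWindow ϕ b))
      (radialPair V (shiftMean ϕ b)) b := fun b hb =>
    hasDerivAt_radialPair_halfWindow hρ hV.locallyIntegrableOn h (lt_sub_comm.1 hb)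
  have hy : ∀ b, |b| < α - ρ → HasDerivAt (fun b => radialPair V (shiftMean ϕ b))
      (-(k ^ 2) • radialPair V (halfWindow ϕ b)) b := fun b hb => by
    convert! hV.hasDerivAt_radialPair_shiftMean hρ h (lt_sub_comm.1 hb) using 1
    simp only [radialPair, smul_comm _ (-(k ^ 2)), integral_smul]
  have hzero : radialPair V (halfWindow ϕ 0) = 0 := by
    simp only [halfWindow_zero, radialPair, Pi.zero_apply, zero_div, zero_smul, integral_zero]
  constructor
  · have hyz := eq_cos_smul_add_sinc_smul hy (fun b hb => (hz b hb).const_smul (-(k ^ 2)))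
      (lt_sub_comm.1 hb)
    simpa only [shiftMean_zero, hzero, smul_zero, add_zero] using hyz
  · simpa only [shiftMean_zero, hzero, smul_zero, zero_add] using
      eq_cos_smul_add_sinc_smul hz hy (lt_sub_comm.1 hb)

lemma fourier_radialTest_shiftMean (h : IsProfile α β ϕ) {b : ℝ} (hb : |b| < α) (ξ : E3) :
    𝓕 (radialTest (shiftMean ϕ b)) ξ = cosSymbol b ξ * 𝓕 (radialTest ϕ) ξ := by
  rw [fourier_radialTest (h.shiftMean b) (sub_pos.2 hb),
    fourier_radialTest h ((abs_nonneg b).trans_lt hb),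
    ((hasRadialLaplacian_fourierChar ξ).radialPair_of_eigenfunction le_rfl h (sub_pos.2 hb)).1,
    Complex.real_smul, cosSymbol]

lemma fourier_radialTest_halfWindow (h : IsProfile α β ϕ) {b : ℝ} (hb : |b| < α) (ξ : E3) :
    𝓕 (radialTest (halfWindow ϕ b)) ξ = sinSymbol b ξ * 𝓕 (radialTest ϕ) ξ := by
  rw [fourier_radialTest (h.halfWindow b) (sub_pos.2 hb),
    fourier_radialTest h ((abs_nonneg b).trans_lt hb),
    ((hasRadialLaplacian_fourierChar ξ).radialPair_of_eigenfunction le_rfl h (sub_pos.2 hb)).2,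
    Complex.real_smul, sinSymbol]

lemma fourierMultiplierCLM_eq_of_fourier_eq {E : Type*} [NormedAddCommGroup E]
    [InnerProductSpace ℝ E] [FiniteDimensional ℝ E] [MeasurableSpace E] [BorelSpace E]
    {g : E → ℂ} (hg : g.HasTemperateGrowth) {φ χ : 𝓢(E, ℂ)} (h : ∀ ξ, 𝓕 χ ξ = g ξ * 𝓕 φ ξ) :
    SchwartzMap.fourierMultiplierCLM ℂ g φ = χ := by
  have hfourier : SchwartzMap.smulLeftCLM ℂ g (𝓕 φ) = 𝓕 χ := by
    ext ξ
    rw [SchwartzMap.smulLeftCLM_apply_apply hg, h, smul_eq_mul]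
  rw [SchwartzMap.fourierMultiplierCLM_apply, hfourier, FourierTransform.fourierInv_fourier_eq]

lemma temperedFourierMultiplierCLM_apply_of_fourier_eq {E : Type*} [NormedAddCommGroup E]
    [InnerProductSpace ℝ E] [FiniteDimensional ℝ E] [MeasurableSpace E] [BorelSpace E]
    {g : E → ℂ} (hg : g.HasTemperateGrowth) (heven : g.Even) {φ χ : 𝓢(E, ℂ)}
    (h : ∀ ξ, 𝓕 χ ξ = g ξ * 𝓕 φ ξ) (T : 𝓢'(E, ℂ)) :
    TemperedDistribution.fourierMultiplierCLM ℂ g T φ = T χ := by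
  have hinv : ∀ (f : 𝓢(E, ℂ)) (ξ : E), 𝓕⁻ f ξ = 𝓕 f (-ξ) := fun f ξ => by
    rw [SchwartzMap.fourierInv_coe, SchwartzMap.fourier_coe, Real.fourierInv_eq_fourier_neg]
  have hfourier : SchwartzMap.smulLeftCLM ℂ g (𝓕⁻ φ) = 𝓕⁻ χ := by
    ext ξ
    rw [SchwartzMap.smulLeftCLM_apply_apply hg, hinv, hinv, h, heven, smul_eq_mul]
  rw [TemperedDistribution.fourierMultiplierCLM_apply_apply, hfourier,
    FourierTransform.fourier_fourierInv_eq]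

lemma even_cosSymbol (b : ℝ) : (cosSymbol b).Even := fun ξ => by
  rw [cosSymbol, cosSymbol, norm_neg]

lemma even_sinSymbol (b : ℝ) : (sinSymbol b).Even := fun ξ => by
  rw [sinSymbol, sinSymbol, norm_neg]

lemma fourierMultiplierCLM_sinSymbol_radialTest (h : IsProfile α β ϕ) {b : ℝ} (hb : |b| < α) :
    SchwartzMap.fourierMultiplierCLM ℂ (sinSymbol b) (radialTest ϕ) =
      radialTest (halfWindow ϕ b) :=
  fourierMultiplierCLM_eq_of_fourier_eq (hasTemperateGrowth_sinSymbol b)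
    (fourier_radialTest_halfWindow h hb)

lemma freeWave_radialTest (h : IsProfile α β ϕ) {b : ℝ} (hb : |b| < α) (f₀ f₁ : 𝓢'(E3, ℂ)) :
    freeWave b f₀ f₁ (radialTest ϕ) =
      f₀ (radialTest (shiftMean ϕ b)) + f₁ (radialTest (halfWindow ϕ b)) := by
  rw [freeWave, add_apply,
    temperedFourierMultiplierCLM_apply_of_fourier_eq (hasTemperateGrowth_cosSymbol b)
      (even_cosSymbol b) (fourier_radialTest_shiftMean h hb),
    temperedFourierMultiplierCLM_apply_of_fourier_eq (hasTemperateGrowth_sinSymbol b)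
      (even_sinSymbol b) (fourier_radialTest_halfWindow h hb)]

end Propagator

section Stationary

variable {α β ρ : ℝ} {ϕ χ v v₁ v₂ : ℝ → ℝ} {V L : E3 → ℝ}

lemma integral_comp_norm (f : ℝ → ℝ) :
    ∫ x : E3, f ‖x‖ = 4 * Real.pi * ∫ r in Set.Ioi (0 : ℝ), r ^ 2 * f r := by
  have hvol : (volume : Measure E3).real (Metric.ball 0 1) = 4 / 3 * Real.pi := by
    rw [Measure.real, EuclideanSpace.volume_ball_fin_three, ENNReal.toReal_mul,
      ENNReal.toReal_pow, ENNReal.toReal_ofReal zero_le_one, one_pow, one_mul,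
      ENNReal.toReal_ofReal (by positivity)]
    ring
  rw [integral_fun_norm_addHaar (volume : Measure E3) f, hvol]
  simp only [finrank_euclideanSpace, Fintype.card_fin, nsmul_eq_mul, smul_eq_mul,
    Nat.add_one_sub_one]
  push_cast
  ring

lemma radialPair_eq_integral (h : IsProfile α β ϕ) (hα : 0 < α)
    (hV : ∀ x, α ≤ ‖x‖ → V x = v ‖x‖ / ‖x‖) :
    radialPair V ϕ = 4 * Real.pi * ∫ r, v r * ϕ r := by
  have hnorm : radialPair V ϕ = ∫ x : E3, (fun r => ϕ r / r * (v r / r)) ‖x‖ := by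
    refine integral_congr_ae (Eventually.of_forall fun x => ?_)
    by_cases hx : ‖x‖ ∈ Set.Icc α β
    · simp only [hV x hx.1, smul_eq_mul]
    · simp only [h.eq_zero _ hx, zero_div, zero_mul, zero_smul]
  rw [hnorm, integral_comp_norm fun r => ϕ r / r * (v r / r),
    ← integral_indicator measurableSet_Ioi]
  congr 2 with r
  by_cases hr : r ∈ Set.Ioi (0 : ℝ)
  · have hr0 : r ≠ 0 := ne_of_gt hr
    rw [Set.indicator_of_mem hr]
    field_simp
  · rw [Set.indicator_of_notMem hr, h.eq_zero r fun hr' => hr (hα.trans_le hr'.1), mul_zero]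

lemma IsProfile.integrable_mul (h : IsProfile α β ϕ) (hα : ρ < α)
    (hv : ContinuousOn v (Set.Ioi ρ)) : Integrable fun r => v r * ϕ r := by
  have hs : tsupport ϕ ⊆ Set.Icc α β :=
    closure_minimal (fun r hr => by_contra fun hr' => hr (h.eq_zero r hr')) isClosed_Icc
  simpa only [smul_eq_mul, mul_comm] using integrable_smul_of_locallyIntegrableOn
    (hv.locallyIntegrableOn measurableSet_Ioi) h.continuous h.hasCompactSupport
    (hs.trans fun r hr => hα.trans_le hr.1)

lemma integral_mul_deriv_profile (h : IsProfile α β χ) (hα : ρ < α)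
    (hv : ∀ r, ρ < r → HasDerivAt v (v₁ r) r) (hv₁ : ContinuousOn v₁ (Set.Ioi ρ)) :
    ∫ r, v r * deriv χ r = -∫ r, v₁ r * χ r := by
  have hvc : ContinuousOn v (Set.Ioi ρ) := fun r hr => (hv r hr).continuousAt.continuousWithinAt
  have hderiv : ∀ r, HasDerivAt (fun r => v r * χ r) (v₁ r * χ r + v r * deriv χ r) r := by
    intro r
    rcases lt_or_ge ρ r with hr | hr
    · exact (hv r hr).mul (h.hasDerivAt r)
    · have hout : r ∉ Set.Icc α β := fun hr' => by linarith [hr'.1]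
      rw [h.eq_zero r hout, h.deriv.eq_zero r hout, mul_zero, mul_zero, add_zero]
      refine (hasDerivAt_const r (0 : ℝ)).congr_of_eventuallyEq ?_
      filter_upwards [h.eventuallyEq_zero hout] with s hs
      rw [hs, Pi.zero_apply, mul_zero]
  have hzero := integral_eq_zero_of_hasDerivAt_of_integrable hderiv
    ((h.integrable_mul hα hv₁).add (h.deriv.integrable_mul hα hvc)) (h.integrable_mul hα hvc)
  rw [integral_add (h.integrable_mul hα hv₁) (h.deriv.integrable_mul hα hvc)] at hzero
  linarith

lemma continuousOn_comp_norm_div_norm (hρ : 0 ≤ ρ) (hv : ContinuousOn v (Set.Ioi ρ)) :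
    ContinuousOn (fun x : E3 => v ‖x‖ / ‖x‖) {x | ρ < ‖x‖} :=
  (hv.comp continuous_norm.continuousOn fun _ hx => hx).div continuous_norm.continuousOn
    fun _ hx => (hρ.trans_lt hx).ne'

lemma measurableSet_lt_norm (ρ : ℝ) : MeasurableSet {x : E3 | ρ < ‖x‖} :=
  measurableSet_lt measurable_const measurable_norm

lemma hasRadialLaplacian_of_hasDerivAt (hρ : 0 ≤ ρ) (hv : ∀ r, ρ < r → HasDerivAt v (v₁ r) r)
    (hv₁ : ∀ r, ρ < r → HasDerivAt v₁ (v₂ r) r) (hv₂ : ContinuousOn v₂ (Set.Ioi ρ))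
    (hV : ∀ x, ρ < ‖x‖ → V x = v ‖x‖ / ‖x‖) (hL : ∀ x, ρ < ‖x‖ → L x = v₂ ‖x‖ / ‖x‖) :
    HasRadialLaplacian ρ V L where
  locallyIntegrableOn := ((continuousOn_comp_norm_div_norm hρ fun r hr =>
    (hv r hr).continuousAt.continuousWithinAt).congr hV).locallyIntegrableOn
      (measurableSet_lt_norm ρ)
  locallyIntegrableOn_laplacian :=
    ((continuousOn_comp_norm_div_norm hρ hv₂).congr hL).locallyIntegrableOn
      (measurableSet_lt_norm ρ)
  radialPair_deriv_deriv {α β χ} hα h := by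
    have hv₁c : ContinuousOn v₁ (Set.Ioi ρ) :=
      fun r hr => (hv₁ r hr).continuousAt.continuousWithinAt
    rw [radialPair_eq_integral h.deriv.deriv (hρ.trans_lt hα) fun x hx => hV x (hα.trans_le hx),
      radialPair_eq_integral h (hρ.trans_lt hα) fun x hx => hL x (hα.trans_le hx),
      integral_mul_deriv_profile h.deriv hα hv hv₁c, integral_mul_deriv_profile h hα hv₁ hv₂,
      neg_neg]

lemma hasRadialLaplacian_norm_rpow (hρ : 0 ≤ ρ) (q : ℝ) :
    HasRadialLaplacian ρ (fun x => ‖x‖ ^ (q - 1)) (fun x => q * (q - 1) * ‖x‖ ^ (q - 3)) := by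
  refine hasRadialLaplacian_of_hasDerivAt hρ (v := fun r => r ^ q)
    (v₁ := fun r => q * r ^ (q - 1)) (v₂ := fun r => q * ((q - 1) * r ^ (q - 1 - 1)))
    (fun r hr => Real.hasDerivAt_rpow_const (Or.inl (hρ.trans_lt hr).ne'))
    (fun r hr => (Real.hasDerivAt_rpow_const (Or.inl (hρ.trans_lt hr).ne')).const_mul q)
    (continuousOn_const.mul (continuousOn_const.mul (continuousOn_id.rpow_const
      fun r hr => Or.inl (hρ.trans_lt hr).ne')))
    (fun x hx => Real.rpow_sub_one (hρ.trans_lt hx).ne' q) fun x hx => ?_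
  have hx0 : ‖x‖ ≠ 0 := (hρ.trans_lt hx).ne'
  rw [show q - 3 = q - 1 - 1 - 1 by ring, Real.rpow_sub_one hx0 (q - 1 - 1)]
  ring

lemma hasRadialLaplacian_laplacian (hρ : 0 ≤ ρ) (hV : ContDiffOn ℝ 2 V {x | ρ < ‖x‖})
    (hrad : IsRadialOn V {x | ρ < ‖x‖}) : HasRadialLaplacian ρ V (Δ V) := by
  obtain ⟨e, he⟩ := exists_norm_eq E3 zero_le_one
  have hnorm : ∀ r, ρ < r → ‖r • e‖ = r := fun r hr => by
    rw [norm_smul, he, mul_one, Real.norm_of_nonneg (hρ.trans hr.le)]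
  have hmem : ∀ r, ρ < r → r • e ∈ {x : E3 | ρ < ‖x‖} := fun r hr => hr.trans_eq (hnorm r hr).symm
  set v : ℝ → ℝ := fun r => r * V (r • e)
  have hv : ContDiffOn ℝ (1 + 1) v (Set.Ioi ρ) :=
    contDiffOn_id.mul (hV.comp (contDiff_id.smul contDiff_const).contDiffOn hmem)
  have hv₁ : ContDiffOn ℝ 1 (deriv v) (Set.Ioi ρ) :=
    ((contDiffOn_succ_iff_deriv_of_isOpen isOpen_Ioi).1 hv).2.2
  have hd : ∀ r, ρ < r → HasDerivAt v (deriv v r) r := fun r hr =>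
    ((hv.differentiableOn (by norm_num)).differentiableAt (Ioi_mem_nhds hr)).hasDerivAt
  have hd₁ : ∀ r, ρ < r → HasDerivAt (deriv v) (deriv (deriv v) r) r := fun r hr =>
    ((hv₁.differentiableOn one_ne_zero).differentiableAt (Ioi_mem_nhds hr)).hasDerivAt
  have heq : ∀ x, ρ < ‖x‖ → V x = v ‖x‖ / ‖x‖ := fun x hx => by
    rw [mul_div_cancel_left₀ _ (hρ.trans_lt hx).ne']
    exact hrad x hx _ (hmem _ hx) (hnorm _ hx).symm
  refine hasRadialLaplacian_of_hasDerivAt hρ hd hd₁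
    (hv₁.continuousOn_deriv_of_isOpen isOpen_Ioi le_rfl) heq fun x hx => ?_
  have hnear : V =ᶠ[𝓝 x] fun y => v ‖y‖ / ‖y‖ := by
    filter_upwards [(isOpen_lt continuous_const continuous_norm).mem_nhds hx] with y hy
      using heq y hy
  rw [(InnerProductSpace.laplacian_congr_nhds hnear).self_of_nhds]
  refine laplacian_comp_norm_div_norm (norm_pos_iff.1 (hρ.trans_lt hx)) ?_ (hd₁ _ hx)
  filter_upwards [Ioi_mem_nhds hx] with r hr using hd r hr

end Stationary

section PairingBounds

variable {α β ρ A q : ℝ} {ϕ : ℝ → ℝ} {f L V : E3 → ℝ}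

lemma HasRadialLaplacian.const_mul (h : HasRadialLaplacian ρ V L) (c : ℝ) :
    HasRadialLaplacian ρ (fun x => c * V x) (fun x => c * L x) where
  locallyIntegrableOn := h.locallyIntegrableOn.smul c
  locallyIntegrableOn_laplacian := h.locallyIntegrableOn_laplacian.smul c
  radialPair_deriv_deriv hα hχ := by
    simp only [radialPair_const_mul_left, h.radialPair_deriv_deriv hα hχ]

lemma abs_radialPair_le (hρ : 0 ≤ ρ) (hα : ρ < α) (h : IsProfile α β ϕ) (hn : ∀ r, 0 ≤ ϕ r)
    (hL : LocallyIntegrableOn L {x | ρ < ‖x‖}) (hf : ∀ᵐ x, α ≤ ‖x‖ → |f x| ≤ L x) :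
    |radialPair f ϕ| ≤ radialPair L ϕ := by
  refine norm_integral_le_of_norm_le (h.integrable_radialPair hρ hα hL)
    (f := fun x => (ϕ ‖x‖ / ‖x‖) • f x) ?_
  filter_upwards [hf] with x hx
  rw [norm_smul, Real.norm_of_nonneg (div_nonneg (hn _) (norm_nonneg _)), smul_eq_mul]
  by_cases hx' : ‖x‖ ∈ Set.Icc α β
  · exact mul_le_mul_of_nonneg_left (hx hx'.1)
      (div_nonneg (hn _) (norm_nonneg _))
  · simp only [h.eq_zero _ hx', zero_div, zero_mul, le_refl]

lemma abs_radialPair_le_of_decay (hρ : 0 ≤ ρ) (hα : ρ < α) (h : IsProfile α β ϕ)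
    (hn : ∀ r, 0 ≤ ϕ r) (hA : 0 ≤ A) (hq : q ≤ 0)
    (hf : ∀ᵐ x, ρ < ‖x‖ → |f x| ≤ A * ‖x‖ ^ (q - 1)) :
    |radialPair f ϕ| ≤ 4 * Real.pi * (A * ∫ r, ϕ r) * α ^ q := by
  have hα0 : 0 < α := hρ.trans_lt hα
  have hcoulomb : LocallyIntegrableOn (fun x : E3 => A * α ^ q / ‖x‖) {x | ρ < ‖x‖} :=
    (continuousOn_comp_norm_div_norm hρ continuousOn_const).locallyIntegrableOn
      (measurableSet_lt_norm ρ)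
  have hle : ∀ᵐ x, α ≤ ‖x‖ → |f x| ≤ A * α ^ q / ‖x‖ := by
    filter_upwards [hf] with x hx hαx
    refine (hx (hα.trans_le hαx)).trans ?_
    rw [Real.rpow_sub_one (hα0.trans_le hαx).ne', ← mul_div_assoc]
    have hpow := Real.rpow_le_rpow_of_nonpos hα0 hαx hq
    gcongr
  refine (abs_radialPair_le hρ hα h hn hcoulomb hle).trans_eq ?_
  rw [radialPair_eq_integral h hα0 (v := fun _ => A * α ^ q) fun _ _ => rfl, integral_const_mul]
  ring

lemma abs_radialPair_comp_sub_le {a b : ℝ} (hρ : 0 ≤ ρ) (hα : ρ < α) (h : IsProfile α β ϕ)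
    (hn : ∀ r, 0 ≤ ϕ r) (hA : 0 ≤ A) (hq : q ≤ 0) (ha : 0 ≤ a) (hab : a ≤ b)
    (hf : ∀ᵐ x, ρ < ‖x‖ → |f x| ≤ A * ‖x‖ ^ (q - 1)) :
    |radialPair f (fun r => ϕ (r - b))| ≤ 4 * Real.pi * (A * ∫ r, ϕ r) * (α + a) ^ q := by
  have hb := abs_radialPair_le_of_decay hρ (by linarith) (h.comp_sub b) (fun r => hn _) hA hq hf
  rw [integral_sub_right_eq_self] at hb
  have hα0 : 0 < α + a := by linarith
  have hint : 0 ≤ ∫ r, ϕ r := integral_nonneg hn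
  exact hb.trans (mul_le_mul_of_nonneg_left
    (Real.rpow_le_rpow_of_nonpos hα0 (by linarith) hq) (by positivity))

end PairingBounds

section Duhamel

/-- `u` solves `∂ₜ²u - Δu = F(|x|,u)` for all times, in integrated form: `U t` and `ut t` are
`u(·,t)` and `∂ₜu(·,t)` as tempered distributions. These are the conditions of `IsGlobalSolution`
that involve no function space. -/
structure IsDuhamelSolution (F : ℝ → ℝ → ℝ) (u : ℝ → E3 → ℝ) (U ut : ℝ → 𝓢'(E3, ℂ)) : Prop where
  measurable : AEStronglyMeasurable (fun z : ℝ × E3 => u z.1 z.2)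
  represents : ∀ t, IsRepresentedBy (U t) (fun x => (u t x : ℂ))
  time_deriv : ∀ t (φ : 𝓢(E3, ℂ)), HasDerivAt (fun τ => U τ φ) (ut t φ) t
  duhamel : ∀ (t t₀ : ℝ) (φ : 𝓢(E3, ℂ)),
    U t φ = freeWave (t - t₀) (U t₀) (ut t₀) φ +
      ∫ τ in t₀..t, ∫ x, (F ‖x‖ (u τ x) : ℂ) *
        SchwartzMap.fourierMultiplierCLM ℂ (sinSymbol (t - τ)) φ x

lemma IsGlobalSolution.isDuhamelSolution {p : ℝ} {F : ℝ → ℝ → ℝ} {u : ℝ → E3 → ℝ}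
    {U ut : ℝ → 𝓢'(E3, ℂ)} (h : IsGlobalSolution p F u U ut) : IsDuhamelSolution F u U ut :=
  ⟨h.measurable, h.represents, h.time_deriv, h.duhamel⟩

variable {F : ℝ → ℝ → ℝ} {u : ℝ → E3 → ℝ} {U ut : ℝ → 𝓢'(E3, ℂ)} {α β : ℝ} {ϕ : ℝ → ℝ}

lemma radialPair_ofReal (f : E3 → ℝ) (ϕ : ℝ → ℝ) :
    radialPair (fun x => (f x : ℂ)) ϕ = ((radialPair f ϕ : ℝ) : ℂ) := by
  simp only [radialPair, smul_eq_mul, ← integral_complex_ofReal, Complex.real_smul,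
    Complex.ofReal_mul]

namespace IsDuhamelSolution

lemma apply_radialTest (hu : IsDuhamelSolution F u U ut) (h : IsProfile α β ϕ) (hα : 0 < α)
    (t : ℝ) : U t (radialTest ϕ) = ((radialPair (u t) ϕ : ℝ) : ℂ) := by
  rw [(hu.represents t (radialTest ϕ)).2, integral_radialTest_mul h hα, radialPair_ofReal]

lemma radialPair_add (hu : IsDuhamelSolution F u U ut) (h : IsProfile α β ϕ) {s : ℝ}
    (hs : |s| < α) (t : ℝ) :
    ((radialPair (u (t + s)) ϕ : ℝ) : ℂ) = ((radialPair (u t) (shiftMean ϕ s) : ℝ) : ℂ) +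
      ut t (radialTest (halfWindow ϕ s)) +
      ((∫ b in (0 : ℝ)..s, radialPair (fun x => F ‖x‖ (u (t + s - b) x)) (halfWindow ϕ b) : ℝ) :
        ℂ) := by
  rw [← hu.apply_radialTest h ((abs_nonneg s).trans_lt hs), hu.duhamel (t + s) t,
    add_sub_cancel_left, freeWave_radialTest h hs,
    hu.apply_radialTest (h.shiftMean s) (sub_pos.2 hs), ← intervalIntegral.integral_ofReal]
  have hsubst := intervalIntegral.integral_comp_sub_left (a := 0) (b := s) (fun τ => ∫ x,
    (F ‖x‖ (u τ x) : ℂ) * SchwartzMap.fourierMultiplierCLM ℂ (sinSymbol (t + s - τ))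
      (radialTest ϕ) x) (t + s)
  rw [sub_zero, add_sub_cancel_right] at hsubst
  rw [← hsubst]
  congr 1
  refine intervalIntegral.integral_congr fun b hb => ?_
  have hbα : |b| < α := (abs_le_abs_of_mem_uIcc hb).trans_lt hs
  simp only [sub_sub_cancel]
  rw [fourierMultiplierCLM_sinSymbol_radialTest h hbα, ← radialPair_ofReal,
    ← integral_radialTest_mul (h.halfWindow b) (sub_pos.2 hbα)]
  simp only [mul_comm]

lemma radialPair_add_add_radialPair_sub (hu : IsDuhamelSolution F u U ut) (h : IsProfile α β ϕ)
    {a : ℝ} (ha : |a| < α) (t : ℝ) :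
    radialPair (u (t + a)) ϕ + radialPair (u (t - a)) ϕ = 2 * radialPair (u t) (shiftMean ϕ a) +
      (∫ b in (0 : ℝ)..a, radialPair (fun x => F ‖x‖ (u (t + a - b) x)) (halfWindow ϕ b)) +
      ∫ b in (0 : ℝ)..a, radialPair (fun x => F ‖x‖ (u (t - a + b) x)) (halfWindow ϕ b) := by
  have hneg : ∀ b, halfWindow ϕ (-b) = fun r => -1 * halfWindow ϕ b r := fun b =>
    funext fun r => by rw [halfWindow_neg, neg_one_mul]
  have hodd : radialTest (halfWindow ϕ (-a)) = -radialTest (halfWindow ϕ a) := by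
    ext x
    rw [neg_apply, radialTest_apply (h.halfWindow (-a)) (by rwa [abs_neg, sub_pos]),
      radialTest_apply (h.halfWindow a) (sub_pos.2 ha), halfWindow_neg, neg_div, Complex.ofReal_neg]
  have hreflect :
      ∫ b in (0 : ℝ)..-a, radialPair (fun x => F ‖x‖ (u (t + -a - b) x)) (halfWindow ϕ b) =
      ∫ b in (0 : ℝ)..a, radialPair (fun x => F ‖x‖ (u (t - a + b) x)) (halfWindow ϕ b) := by
    rw [← neg_zero, ← intervalIntegral.integral_comp_neg, intervalIntegral.integral_symm,
      ← intervalIntegral.integral_neg, neg_zero]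
    refine intervalIntegral.integral_congr fun b _ => ?_
    simp only [hneg, radialPair_const_mul_right, smul_eq_mul, sub_neg_eq_add, ← sub_eq_add_neg]
    ring
  have hplus := hu.radialPair_add h ha t
  have hminus := hu.radialPair_add h (s := -a) (by rwa [abs_neg]) t
  rw [hodd, map_neg, hreflect, shiftMean_neg, ← sub_eq_add_neg] at hminus
  apply Complex.ofReal_injective
  push_cast at hplus hminus ⊢
  linear_combination hplus + hminus

end IsDuhamelSolution

end Duhamel

section Comparison

variable {F : ℝ → ℝ → ℝ} {u : ℝ → E3 → ℝ} {α β ρ : ℝ} {ϕ : ℝ → ℝ} {V W L LW : E3 → ℝ}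

lemma aestronglyMeasurable_comp_norm {X : Type*} [MeasurableSpace X] {μ : Measure X}
    (hF : ContinuousOn (fun z : ℝ × ℝ => F z.1 z.2) (Set.Ici 0 ×ˢ Set.univ)) {y : X → E3}
    {f : X → ℝ} (hy : Measurable y) (hf : AEStronglyMeasurable f μ) :
    AEStronglyMeasurable (fun x => F ‖y x‖ (f x)) μ := by
  have hFmax : Continuous fun z : ℝ × ℝ => F (max z.1 0) z.2 :=
    hF.comp_continuous (f := fun z : ℝ × ℝ => (max z.1 0, z.2)) (by fun_prop)
      fun z => ⟨Set.mem_Ici.2 (le_max_right _ _), trivial⟩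
  simpa only [max_eq_left (norm_nonneg _)] using
    hFmax.comp_aestronglyMeasurable (hy.norm.aestronglyMeasurable.prodMk hf)

lemma aestronglyMeasurable_radialPair_halfWindow {f : ℝ → E3 → ℝ}
    (hf : AEStronglyMeasurable (fun z : ℝ × E3 => f z.1 z.2)) (hϕ : Continuous ϕ) :
    AEStronglyMeasurable fun b => radialPair (f b) (halfWindow ϕ b) := by
  have hwindow : Continuous fun z : ℝ × E3 => halfWindow ϕ z.1 ‖z.2‖ :=
    (continuous_halfWindow_uncurry hϕ).comp (continuous_fst.prodMk continuous_snd.norm)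
  exact ((hwindow.measurable.div measurable_snd.norm).aestronglyMeasurable.smul
    hf).integral_prod_right'

lemma abs_integral_radialPair_add_le {f : ℝ → E3 → ℝ} (hρ : 0 ≤ ρ)
    (hf : AEStronglyMeasurable (fun z : ℝ × E3 => f z.1 z.2))
    (hfl : ∀ b, LocallyIntegrableOn (f b) {x | ρ < ‖x‖})
    (hW : HasRadialLaplacian ρ W LW) (hV : HasRadialLaplacian ρ V L)
    (hle : ∀ b, ∀ᵐ x, ρ < ‖x‖ → |f b x + LW x| ≤ L x)
    (h : IsProfile α β ϕ) (hn : ∀ r, 0 ≤ ϕ r) {a : ℝ} (ha : 0 ≤ a) (haα : ρ < α - a) :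
    |(∫ b in (0 : ℝ)..a, radialPair (f b) (halfWindow ϕ b)) +
      (radialPair W (shiftMean ϕ a) - radialPair W ϕ)| ≤
      radialPair V (shiftMean ϕ a) - radialPair V ϕ := by
  have haα' : ρ < α - |a| := by rwa [abs_of_nonneg ha]
  have hLi := intervalIntegrable_radialPair_halfWindow hρ hV.locallyIntegrableOn_laplacian h haα'
  have hLWi := intervalIntegrable_radialPair_halfWindow hρ hW.locallyIntegrableOn_laplacian h haα'
  have hpoint : ∀ b ∈ Set.uIoc 0 a, |radialPair (f b) (halfWindow ϕ b) +
      radialPair LW (halfWindow ϕ b)| ≤ radialPair L (halfWindow ϕ b) := fun b hb => by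
    rw [Set.uIoc_of_le ha] at hb
    have hbα : ρ < α - |b| := by rw [abs_of_pos hb.1]; linarith [hb.2]
    rw [← radialPair_add_left hρ hbα (hfl b) hW.locallyIntegrableOn_laplacian (h.halfWindow b)]
    refine abs_radialPair_le hρ hbα (h.halfWindow b)
      (halfWindow_nonneg hn hb.1.le) hV.locallyIntegrableOn_laplacian ?_
    filter_upwards [hle b] with x hx hxα using hx (hbα.trans_le hxα)
  have hfi : IntervalIntegrable (fun b => radialPair (f b) (halfWindow ϕ b)) volume 0 a := by
    refine (hLi.add hLWi.abs).mono_fun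
      (aestronglyMeasurable_radialPair_halfWindow hf h.continuous).restrict ?_
    filter_upwards [ae_restrict_mem measurableSet_uIoc] with b hb
    have htri := abs_sub_abs_le_abs_add (radialPair (f b) (halfWindow ϕ b))
      (radialPair LW (halfWindow ϕ b))
    rw [Real.norm_eq_abs, Real.norm_eq_abs]
    exact le_trans (by linarith [hpoint b hb]) (le_abs_self _)
  rw [← hW.integral_radialPair_halfWindow hρ h haα', ← hV.integral_radialPair_halfWindow hρ h haα',
    ← intervalIntegral.integral_add hfi hLWi]
  exact intervalIntegral.norm_integral_le_of_norm_le ha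
    (f := fun b => radialPair (f b) (halfWindow ϕ b) + radialPair LW (halfWindow ϕ b))
    (Eventually.of_forall fun b hb => hpoint b (by rwa [Set.uIoc_of_le ha])) hLi

end Comparison

section AlmostEverywhere

lemma ae_comp_norm {E : Type*} [NormedAddCommGroup E] [NormedSpace ℝ E] [FiniteDimensional ℝ E]
    [Nontrivial E] [MeasurableSpace E] [BorelSpace E] {μ : Measure E} [μ.IsAddHaarMeasure]
    {P : ℝ → Prop} (h : ∀ᵐ r, P r) : ∀ᵐ x ∂μ, P ‖x‖ := by
  set N : ℝ → ℝ := Set.indicator {r | ¬ P r} 1 with hN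
  have hN0 : ∀ᵐ r : ℝ, r ^ (Module.finrank ℝ E - 1) • N r = 0 := by
    filter_upwards [h] with r hr
    rw [hN, Set.indicator_of_notMem (by simpa using hr), smul_zero]
  have hint : Integrable (fun x => N ‖x‖) μ :=
    (integrable_fun_norm_addHaar μ).2 ((integrable_zero _ _ _).congr
      (ae_restrict_of_ae (hN0.mono fun _ hr => hr.symm)))
  have hzero : ∫ x, N ‖x‖ ∂μ = 0 := by
    rw [integral_fun_norm_addHaar μ, integral_eq_zero_of_ae (ae_restrict_of_ae hN0), smul_zero,
      smul_zero]
  have hnonneg : 0 ≤ fun x : E => N ‖x‖ :=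
    fun x => Set.indicator_nonneg (fun _ _ => zero_le_one) _
  filter_upwards [(integral_eq_zero_iff_of_nonneg hnonneg hint).1 hzero] with x hx
  by_contra hP
  exact one_ne_zero ((Set.indicator_of_mem (s := {r | ¬ P r}) hP 1).symm.trans hx)

section Testing

variable {E : Type*} [NormedAddCommGroup E] [NormedSpace ℝ E] [FiniteDimensional ℝ E]
  [HasContDiffBump E] [MeasurableSpace E] [BorelSpace E] {μ : Measure E} [μ.IsAddHaarMeasure]
  {k : E → ℝ}

lemma ae_nonpos_on_ball {c : E} {r : ℝ} (hk : IntegrableOn k (Metric.closedBall c r) μ)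
    (h : ∀ φ : E → ℝ, ContDiff ℝ (⊤ : ℕ∞) φ → tsupport φ ⊆ Metric.closedBall c r →
      (∀ x, 0 ≤ φ x) → ∫ x, φ x * k x ∂μ ≤ 0) :
    ∀ᵐ x ∂μ, x ∈ Metric.ball c r → k x ≤ 0 := by
  set K := Metric.closedBall c r
  have hKk : Integrable (K.indicator k) μ :=
    (integrable_indicator_iff measurableSet_closedBall).2 hk
  obtain ⟨δ, -, hδ, hδ0⟩ := exists_seq_strictAnti_tendsto (0 : ℝ)
  let bump : ℕ → ContDiffBump (0 : E) := fun n =>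
    ⟨δ n, 2 * δ n, hδ n, by linarith [hδ n]⟩
  have hrOut : Tendsto (fun n => (bump n).rOut) atTop (𝓝 0) := by
    simpa only [mul_zero] using hδ0.const_mul 2
  filter_upwards [ContDiffBump.ae_convolution_tendsto_right_of_locallyIntegrable (K := 2) hrOut
    (Eventually.of_forall fun n => le_rfl) hKk.locallyIntegrable] with x hx hxr
  rw [Set.indicator_of_mem (Metric.ball_subset_closedBall hxr)] at hx
  refine le_of_tendsto hx ?_
  filter_upwards [hrOut.eventually_lt_const (sub_pos.2 (Metric.mem_ball.1 hxr))] with n hn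
  have hsupp : Function.support (fun y => (bump n).normed μ (x - y)) ⊆
      Metric.closedBall x (bump n).rOut := fun y hy => by
    have hy' : x - y ∈ Function.support ((bump n).normed μ) := hy
    rw [ContDiffBump.support_normed_eq, mem_ball_zero_iff, ← dist_eq_norm, dist_comm] at hy'
    exact hy'.le
  have hsub : tsupport (fun y => (bump n).normed μ (x - y)) ⊆ K :=
    (closure_minimal hsupp Metric.isClosed_closedBall).trans
      (Metric.closedBall_subset_closedBall' (by linarith))
  refine le_of_eq_of_le ?_ (h (fun y => (bump n).normed μ (x - y))
    ((bump n).contDiff_normed.comp (contDiff_const.sub contDiff_id)) hsub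
    fun y => (bump n).nonneg_normed _)
  rw [convolution_eq_swap]
  refine integral_congr_ae (Eventually.of_forall fun y => ?_)
  by_cases hy : y ∈ K
  · simp only [Set.indicator_of_mem hy, ContinuousLinearMap.lsmul_apply, smul_eq_mul]
  · simp only [Set.indicator_of_notMem hy, map_zero,
      image_eq_zero_of_notMem_tsupport fun hy' => hy (hsub hy'), zero_mul]

lemma ae_nonpos_of_integral_contDiff_mul_nonpos {Ω : Set E} (hΩ : IsOpen Ω)
    (hk : LocallyIntegrableOn k Ω μ)
    (h : ∀ φ : E → ℝ, ContDiff ℝ (⊤ : ℕ∞) φ → HasCompactSupport φ → tsupport φ ⊆ Ω →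
      (∀ x, 0 ≤ φ x) → ∫ x, φ x * k x ∂μ ≤ 0) :
    ∀ᵐ x ∂μ, x ∈ Ω → k x ≤ 0 := by
  refine measure_null_of_locally_null _ fun c hc => ?_
  have hcΩ : c ∈ Ω := by_contra fun hc' => hc fun hc'' => absurd hc'' hc'
  obtain ⟨r, hr, hrΩ⟩ := Metric.nhds_basis_closedBall.mem_iff.1 (hΩ.mem_nhds hcΩ)
  have hball := ae_nonpos_on_ball
    (hk.integrableOn_compact_subset hrΩ (isCompact_closedBall c r)) fun φ hφ hs hn =>
      h φ hφ ((isCompact_closedBall c r).of_isClosed_subset (isClosed_tsupport φ) hs)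
        (hs.trans hrΩ) hn
  refine ⟨_, inter_mem_nhdsWithin _ (Metric.ball_mem_nhds c hr), measure_mono_null ?_ hball⟩
  exact fun x hx hx' => hx.1 fun _ => hx' hx.2

end Testing

lemma exists_isProfile {ϕ : ℝ → ℝ} {ρ : ℝ} (h : ContDiff ℝ (⊤ : ℕ∞) ϕ) (hc : HasCompactSupport ϕ)
    (hs : tsupport ϕ ⊆ Set.Ioi ρ) : ∃ α β, ρ < α ∧ IsProfile α β ϕ := by
  rcases (tsupport ϕ).eq_empty_or_nonempty with hempty | hne
  · refine ⟨ρ + 1, 0, by linarith, h, fun r _ => image_eq_zero_of_notMem_tsupport ?_⟩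
    simp only [hempty, Set.mem_empty_iff_false, not_false_eq_true]
  obtain ⟨α, hα, hαmin⟩ := hc.exists_isLeast hne
  obtain ⟨β, -, hβmax⟩ := hc.exists_isGreatest hne
  exact ⟨α, β, hs hα, h, fun r hr => image_eq_zero_of_notMem_tsupport fun hr' =>
    hr ⟨hαmin hr', hβmax hr'⟩⟩

variable {ρ : ℝ} {f g B : E3 → ℝ}

/-- A fixed unit vector, along which radial functions are evaluated. -/
def unitVector : E3 := EuclideanSpace.single 0 1

lemma norm_smul_unitVector {r : ℝ} (hr : 0 ≤ r) : ‖r • unitVector‖ = r := by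
  rw [norm_smul, Real.norm_of_nonneg hr, unitVector, PiLp.norm_single, norm_one, mul_one]

lemma IsRadialOn.eq_norm_smul_unitVector (hf : IsRadialOn f {x | ρ < ‖x‖}) {x : E3}
    (hx : ρ < ‖x‖) : f x = f (‖x‖ • unitVector) := by
  have hnorm := norm_smul_unitVector (norm_nonneg x)
  exact hf x hx _ (by rwa [Set.mem_ofPred_eq, hnorm]) hnorm.symm

lemma IsRadialOn.locallyIntegrableOn_Ioi (hρ : 0 ≤ ρ) (hf : IsRadialOn f {x | ρ < ‖x‖})
    (hfl : LocallyIntegrableOn f {x | ρ < ‖x‖}) :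
    LocallyIntegrableOn (fun r => r ^ 2 * f (r • unitVector)) (Set.Ioi ρ) := by
  rw [locallyIntegrableOn_iff isOpen_Ioi.isLocallyClosed]
  intro K hK hKc
  have hpre : (fun x : E3 => ‖x‖) ⁻¹' K ⊆ {x | ρ < ‖x‖} := fun x hx => hK hx
  have hcompact : IsCompact ((fun x : E3 => ‖x‖) ⁻¹' K) := by
    refine Metric.isCompact_of_isClosed_isBounded (hKc.isClosed.preimage continuous_norm) ?_
    obtain ⟨b, hb⟩ := hKc.bddAbove
    exact Metric.isBounded_closedBall.subset fun x hx => mem_closedBall_zero_iff.2 (hb hx)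
  have hint := hfl.integrableOn_compact_subset hpre hcompact
  rw [← integrable_indicator_iff hcompact.measurableSet] at hint
  have hrad : Integrable fun x : E3 => K.indicator (fun r => f (r • unitVector)) ‖x‖ := by
    refine hint.congr (Eventually.of_forall fun x => ?_)
    by_cases hx : ‖x‖ ∈ K
    · beta_reduce
      rw [Set.indicator_of_mem hx, Set.indicator_of_mem (show x ∈ (fun x => ‖x‖) ⁻¹' K from hx),
        hf.eq_norm_smul_unitVector (hpre hx)]
    · beta_reduce
      rw [Set.indicator_of_notMem hx,
        Set.indicator_of_notMem (show x ∉ (fun x => ‖x‖) ⁻¹' K from hx)]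
  have hline := ((integrable_fun_norm_addHaar volume).1 hrad).mono_set
    fun r hr => hρ.trans_lt (hK hr)
  refine hline.congr_fun (fun r hr => ?_) hKc.measurableSet
  simp only [finrank_euclideanSpace, Fintype.card_fin, Nat.add_one_sub_one, smul_eq_mul,
    Set.indicator_of_mem hr]

lemma ae_nonpos_of_radialPair_nonpos (hρ : 0 ≤ ρ) (hf : IsRadialOn f {x | ρ < ‖x‖})
    (hfl : LocallyIntegrableOn f {x | ρ < ‖x‖})
    (h : ∀ {α β ϕ}, ρ < α → IsProfile α β ϕ → (∀ r, 0 ≤ ϕ r) → radialPair f ϕ ≤ 0) :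
    ∀ᵐ x, ρ < ‖x‖ → f x ≤ 0 := by
  have hline : ∀ᵐ r, r ∈ Set.Ioi ρ → r ^ 2 * f (r • unitVector) ≤ 0 := by
    refine ae_nonpos_of_integral_contDiff_mul_nonpos isOpen_Ioi
      (hf.locallyIntegrableOn_Ioi hρ hfl) fun ϕ hϕ hc hs hn => ?_
    obtain ⟨α, β, hα, hp⟩ := exists_isProfile hϕ hc hs
    have hpair := h hα hp.id_mul (hp.id_mul_nonneg (hρ.trans_lt hα) hn)
    rw [radialPair_eq_integral hp.id_mul (hρ.trans_lt hα) (v := fun r => r * f (r • unitVector))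
      fun x hx => by
        rw [hf.eq_norm_smul_unitVector (hα.trans_le hx),
          mul_div_cancel_left₀ _ (hρ.trans_lt (hα.trans_le hx)).ne']] at hpair
    refine le_of_eq_of_le (integral_congr_ae (Eventually.of_forall fun r => ?_))
      (nonpos_of_mul_nonpos_right hpair (by positivity))
    ring
  filter_upwards [ae_comp_norm hline] with x hx hxρ
  rw [hf.eq_norm_smul_unitVector hxρ]
  exact nonpos_of_mul_nonpos_right (hx hxρ) (pow_pos (hρ.trans_lt hxρ) 2)

lemma ae_abs_le_of_abs_radialPair_le (hρ : 0 ≤ ρ) (hf : IsRadialOn f {x | ρ < ‖x‖})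
    (hB : IsRadialOn B {x | ρ < ‖x‖}) (hfl : LocallyIntegrableOn f {x | ρ < ‖x‖})
    (hBl : LocallyIntegrableOn B {x | ρ < ‖x‖})
    (h : ∀ {α β ϕ}, ρ < α → IsProfile α β ϕ → (∀ r, 0 ≤ ϕ r) →
      |radialPair f ϕ| ≤ radialPair B ϕ) :
    ∀ᵐ x, ρ < ‖x‖ → |f x| ≤ B x := by
  have hupper : ∀ᵐ x, ρ < ‖x‖ → f x - B x ≤ 0 := by
    refine ae_nonpos_of_radialPair_nonpos hρ
      (fun x hx y hy hxy => by rw [hf x hx y hy hxy, hB x hx y hy hxy]) (hfl.sub hBl)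
      fun hα hϕ hn => ?_
    rw [radialPair_sub_left hρ hα hfl hBl hϕ]
    linarith [(abs_le.1 (h hα hϕ hn)).2]
  have hneg : LocallyIntegrableOn (fun x => -1 * f x) {x | ρ < ‖x‖} := hfl.smul (-1 : ℝ)
  have hlower : ∀ᵐ x, ρ < ‖x‖ → -1 * f x - B x ≤ 0 := by
    refine ae_nonpos_of_radialPair_nonpos hρ
      (fun x hx y hy hxy => by rw [hf x hx y hy hxy, hB x hx y hy hxy]) (hneg.sub hBl)
      fun hα hϕ hn => ?_
    rw [radialPair_sub_left hρ hα hneg hBl hϕ, radialPair_const_mul_left]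
    linarith [(abs_le.1 (h hα hϕ hn)).1]
  filter_upwards [hupper, hlower] with x hux hlx hx
  exact abs_le.2 ⟨by linarith [hlx hx], by linarith [hux hx]⟩

end AlmostEverywhere

section Barrier

lemma locallyIntegrableOn_of_norm_le {X G : Type*} [MeasurableSpace X] [TopologicalSpace X]
    [NormedAddCommGroup G] {μ : Measure X} {s : Set X} {f : X → G} {B : X → ℝ}
    (hf : AEStronglyMeasurable f (μ.restrict s)) (hB : LocallyIntegrableOn B s μ)
    (h : ∀ᵐ x ∂μ.restrict s, ‖f x‖ ≤ B x) : LocallyIntegrableOn f s μ := fun x hx => by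
  obtain ⟨t, ht, hBt⟩ := hB x hx
  exact ⟨t ∩ s, inter_mem ht self_mem_nhdsWithin,
    (hBt.mono_set Set.inter_subset_left).mono' (hf.mono_set Set.inter_subset_right)
      (ae_restrict_of_ae_restrict_of_subset Set.inter_subset_right h)⟩

variable {F : ℝ → ℝ → ℝ} {u : ℝ → E3 → ℝ} {U ut : ℝ → 𝓢'(E3, ℂ)} {α β ρ : ℝ} {ϕ : ℝ → ℝ}
  {V W L LW : E3 → ℝ}

lemma locallyIntegrableOn_comp_norm_of_abs_add_le {f : E3 → ℝ}
    (hF : ContinuousOn (fun z : ℝ × ℝ => F z.1 z.2) (Set.Ici 0 ×ˢ Set.univ))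
    (hf : LocallyIntegrableOn f {x | ρ < ‖x‖}) (hLW : LocallyIntegrableOn LW {x | ρ < ‖x‖})
    (hL : LocallyIntegrableOn L {x | ρ < ‖x‖})
    (hle : ∀ᵐ x, ρ < ‖x‖ → |F ‖x‖ (f x) + LW x| ≤ L x) :
    LocallyIntegrableOn (fun x => F ‖x‖ (f x)) {x | ρ < ‖x‖} := by
  refine locallyIntegrableOn_of_norm_le
    (aestronglyMeasurable_comp_norm hF measurable_id hf.aestronglyMeasurable) (hL.add hLW.norm) ?_
  rw [ae_restrict_iff' (measurableSet_lt_norm ρ)]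
  filter_upwards [hle] with x hx hxρ
  have htri := abs_sub_abs_le_abs_add (F ‖x‖ (f x)) (LW x)
  simp only [Pi.add_apply, Real.norm_eq_abs]
  linarith [hx hxρ]

lemma radialPair_shiftMean_comp_sub (hρ : 0 ≤ ρ) (hα : ρ < α)
    (hV : LocallyIntegrableOn V {x | ρ < ‖x‖}) (h : IsProfile α β ϕ) {a : ℝ} (ha : 0 ≤ a) :
    2 * radialPair V (shiftMean (fun r => ϕ (r - a)) a) =
      radialPair V ϕ + radialPair V (fun r => ϕ (r - 2 * a)) := by
  have hshift := (h.comp_sub (2 * a)).mono (α' := α) (by linarith) (le_refl _)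
  have hsplit : shiftMean (fun r => ϕ (r - a)) a = fun r => 1 / 2 * (ϕ r + ϕ (r - 2 * a)) := by
    ext r
    rw [shiftMean, add_sub_cancel_right, sub_sub, ← two_mul]
  rw [hsplit, radialPair_const_mul_right, smul_eq_mul,
    radialPair_add_right hρ hα hV (h.mono le_rfl (le_max_left _ _))
      (hshift.mono le_rfl (le_max_right β _))]
  ring

namespace IsDuhamelSolution

lemma abs_radialPair_sub_le (hu : IsDuhamelSolution F u U ut)
    (hF : ContinuousOn (fun z : ℝ × ℝ => F z.1 z.2) (Set.Ici 0 ×ˢ Set.univ)) (hρ : 0 ≤ ρ)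
    (hul : ∀ t, LocallyIntegrableOn (u t) {x | ρ < ‖x‖}) (hW : HasRadialLaplacian ρ W LW)
    (hV : HasRadialLaplacian ρ V L)
    (hle : ∀ t, ∀ᵐ x, ρ < ‖x‖ → |F ‖x‖ (u t x) + LW x| ≤ L x)
    (h : IsProfile α β ϕ) (hn : ∀ r, 0 ≤ ϕ r) {a : ℝ} (ha : 0 ≤ a) (haα : ρ < α - a) (t : ℝ) :
    |radialPair (fun x => u (t + a) x - W x) ϕ + radialPair (fun x => u (t - a) x - W x) ϕ -
      2 * radialPair (fun x => u t x - W x) (shiftMean ϕ a)| ≤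
      2 * (radialPair V (shiftMean ϕ a) - radialPair V ϕ) := by
  have hFm : AEStronglyMeasurable (fun z : ℝ × E3 => F ‖z.2‖ (u z.1 z.2)) :=
    aestronglyMeasurable_comp_norm hF measurable_snd hu.measurable
  have hFl := fun t => locallyIntegrableOn_comp_norm_of_abs_add_le hF (hul t)
    hW.locallyIntegrableOn_laplacian hV.locallyIntegrableOn_laplacian (hle t)
  have hplus := abs_integral_radialPair_add_le (f := fun b x => F ‖x‖ (u (t + a - b) x)) hρ
    (hFm.comp_quasiMeasurePreserving
      ((Measure.measurePreserving_sub_left volume (t + a)).prod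
        (.id volume)).quasiMeasurePreserving)
    (fun b => hFl _) hW hV (fun b => hle _) h hn ha haα
  have hminus := abs_integral_radialPair_add_le (f := fun b x => F ‖x‖ (u (t - a + b) x)) hρ
    (hFm.comp_quasiMeasurePreserving
      ((measurePreserving_add_left volume (t - a)).prod (.id volume)).quasiMeasurePreserving)
    (fun b => hFl _) hW hV (fun b => hle _) h hn ha haα
  have hα : ρ < α := by linarith
  have haα' : |a| < α := by rw [abs_of_nonneg ha]; linarith
  have hmean := (h.shiftMean a).mono (sub_le_sub_left (abs_of_nonneg ha).le α) (le_refl _)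
  rw [radialPair_sub_left hρ hα (hul _) hW.locallyIntegrableOn h,
    radialPair_sub_left hρ hα (hul _) hW.locallyIntegrableOn h,
    radialPair_sub_left hρ haα (hul t) hW.locallyIntegrableOn hmean]
  have hduhamel := hu.radialPair_add_add_radialPair_sub h haα' t
  rw [abs_le] at hplus hminus ⊢
  constructor <;> linarith [hplus.1, hplus.2, hminus.1, hminus.2]

lemma abs_radialPair_le_radialPair {A A' q : ℝ} (hu : IsDuhamelSolution F u U ut)
    (hF : ContinuousOn (fun z : ℝ × ℝ => F z.1 z.2) (Set.Ici 0 ×ˢ Set.univ)) (hρ : 0 ≤ ρ)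
    (hul : ∀ t, LocallyIntegrableOn (u t) {x | ρ < ‖x‖}) (hW : HasRadialLaplacian ρ W LW)
    (hV : HasRadialLaplacian ρ V L)
    (hle : ∀ t, ∀ᵐ x, ρ < ‖x‖ → |F ‖x‖ (u t x) + LW x| ≤ L x)
    (hA : 0 ≤ A) (hA' : 0 ≤ A') (hq : q < 0)
    (hD : ∀ t, ∀ᵐ x, ρ < ‖x‖ → |u t x - W x| ≤ A * ‖x‖ ^ (q - 1))
    (hVA : ∀ᵐ x, ρ < ‖x‖ → |V x| ≤ A' * ‖x‖ ^ (q - 1))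
    (hα : ρ < α) (h : IsProfile α β ϕ) (hn : ∀ r, 0 ≤ ϕ r) (t : ℝ) :
    |radialPair (fun x => u t x - W x) ϕ| ≤ radialPair V ϕ := by
  have hDl : ∀ t, LocallyIntegrableOn (fun x => u t x - W x) {x | ρ < ‖x‖} := fun t =>
    (hul t).sub hW.locallyIntegrableOn
  have hbound : ∀ a, 0 ≤ a → |radialPair (fun x => u t x - W x) ϕ| ≤
      radialPair V ϕ + 3 * (4 * Real.pi * ((A + A') * ∫ r, ϕ r)) * (α + a) ^ q := by
    intro a ha
    have hcomp := hu.abs_radialPair_sub_le hF hρ hul hW hV hle (h.comp_sub a) (fun r => hn _) ha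
      (by rwa [add_sub_cancel_right]) t
    rw [mul_sub, radialPair_shiftMean_comp_sub hρ hα hV.locallyIntegrableOn h ha,
      radialPair_shiftMean_comp_sub hρ hα (hDl t) h ha] at hcomp
    have hDfar := fun t b (hab : a ≤ b) =>
      abs_le.1 (abs_radialPair_comp_sub_le hρ hα h hn hA hq.le ha hab (hD t))
    have hVfar := fun b (hab : a ≤ b) =>
      abs_le.1 (abs_radialPair_comp_sub_le hρ hα h hn hA' hq.le ha hab hVA)
    have hnext := hDfar (t + a) a le_rfl
    have hprev := hDfar (t - a) a le_rfl
    have hDtwo := hDfar t (2 * a) (by linarith)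
    have hVone := hVfar a le_rfl
    have hVtwo := hVfar (2 * a) (by linarith)
    rw [abs_le] at hcomp ⊢
    constructor <;> linarith [hcomp.1, hcomp.2, hnext.1, hnext.2, hprev.1, hprev.2, hDtwo.1,
      hDtwo.2, hVone.1, hVone.2, hVtwo.1, hVtwo.2]
  have hdecay : Tendsto (fun a => (α + a) ^ q) atTop (𝓝 0) := by
    simpa only [neg_neg, Function.comp_def, id] using (tendsto_rpow_neg_atTop (neg_pos.2 hq)).comp
      (tendsto_atTop_add_const_left atTop α tendsto_id)
  refine ge_of_tendsto ?_ ((eventually_ge_atTop 0).mono hbound)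
  simpa only [mul_zero, add_zero] using (hdecay.const_mul _).const_add (radialPair V ϕ)

lemma ae_abs_sub_le {A A' q : ℝ} (hu : IsDuhamelSolution F u U ut)
    (hF : ContinuousOn (fun z : ℝ × ℝ => F z.1 z.2) (Set.Ici 0 ×ˢ Set.univ)) (hρ : 0 ≤ ρ)
    (hur : ∀ t, IsRadialOn (u t) {x | ρ < ‖x‖}) (hWr : IsRadialOn W {x | ρ < ‖x‖})
    (hVr : IsRadialOn V {x | ρ < ‖x‖})
    (hul : ∀ t, LocallyIntegrableOn (u t) {x | ρ < ‖x‖}) (hW : HasRadialLaplacian ρ W LW)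
    (hV : HasRadialLaplacian ρ V L)
    (hle : ∀ t, ∀ᵐ x, ρ < ‖x‖ → |F ‖x‖ (u t x) + LW x| ≤ L x)
    (hA : 0 ≤ A) (hA' : 0 ≤ A') (hq : q < 0)
    (hD : ∀ t, ∀ᵐ x, ρ < ‖x‖ → |u t x - W x| ≤ A * ‖x‖ ^ (q - 1))
    (hVA : ∀ᵐ x, ρ < ‖x‖ → |V x| ≤ A' * ‖x‖ ^ (q - 1)) (t : ℝ) :
    ∀ᵐ x, ρ < ‖x‖ → |u t x - W x| ≤ V x :=
  ae_abs_le_of_abs_radialPair_le hρ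
    (fun x hx y hy hxy => by rw [hur t x hx y hy hxy, hWr x hx y hy hxy]) hVr
    ((hul t).sub hW.locallyIntegrableOn) hV.locallyIntegrableOn fun hα h hn =>
      hu.abs_radialPair_le_radialPair hF hρ hul hW hV hle hA hA' hq hD hVA hα h hn t

end IsDuhamelSolution

end Barrier

section Divergence

variable {α β κ' : ℝ} {κ ψ : ℝ → ℝ} {f : E3 → ℝ} {g : E3 → E3} {Ω : Set E3}

lemma IsWeakGradientOn.integral_mul_divergence (h : IsWeakGradientOn f g Ω) {φ : Fin 3 → E3 → ℝ}
    (hφ : ∀ i, ContDiff ℝ (⊤ : ℕ∞) (φ i)) (hc : ∀ i, HasCompactSupport (φ i))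
    (hs : ∀ i, tsupport (φ i) ⊆ Ω) :
    ∫ x, f x * ∑ i, fderiv ℝ (φ i) x (EuclideanSpace.single i 1) =
      -∫ x, ∑ i, inner ℝ (g x) (EuclideanSpace.single i 1) * φ i x := by
  obtain ⟨hf, hg, hweak⟩ := h
  have hfint (i : Fin 3) :
      Integrable fun x => f x * fderiv ℝ (φ i) x (EuclideanSpace.single i 1) := by
    simp only [mul_comm (f _)]
    exact integrable_smul_of_locallyIntegrableOn hf
      (((hφ i).continuous_fderiv (by simp)).clm_apply continuous_const)
      ((hc i).fderiv_apply (𝕜 := ℝ) _) ((tsupport_fderiv_apply_subset ℝ _).trans (hs i))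
  have hgint (i : Fin 3) :
      Integrable fun x => inner ℝ (g x) (EuclideanSpace.single i 1) * φ i x := by
    refine ((integrable_smul_of_locallyIntegrableOn hg (hφ i).continuous (hc i)
      (hs i)).inner_const (𝕜 := ℝ) (EuclideanSpace.single i 1)).congr
        (Eventually.of_forall fun x => ?_)
    simp only [real_inner_smul_left, mul_comm]
  simp only [Finset.mul_sum]
  rw [integral_finsetSum _ fun i _ => hfint i, integral_finsetSum _ fun i _ => hgint i,
    ← Finset.sum_neg_distrib]
  exact Finset.sum_congr rfl fun i _ => hweak (φ i) (hφ i) (hc i) (hs i) _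

lemma sum_fderiv_comp_norm_mul_coord {x : E3} (hx : x ≠ 0) (hκ : HasDerivAt κ κ' ‖x‖) :
    ∑ i, fderiv ℝ (fun y : E3 => κ ‖y‖ * y i) x (EuclideanSpace.single i 1) =
      3 * κ ‖x‖ + ‖x‖ * κ' := by
  have hcoord (i : Fin 3) : fderiv ℝ (fun y : E3 => κ ‖y‖ * y i) x (EuclideanSpace.single i 1) =
      κ ‖x‖ + κ' / ‖x‖ * x i ^ 2 := by
    have hprod : HasFDerivAt (fun y : E3 => κ ‖y‖ * y i) _ x := (hasFDerivAt_comp_norm hx hκ).mul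
      (EuclideanSpace.proj (𝕜 := ℝ) i).hasFDerivAt
    rw [hprod.fderiv]
    simp only [add_apply, smul_apply, PiLp.proj_apply, PiLp.single_eq_same, smul_eq_mul, mul_one,
      coe_innerSL_apply, EuclideanSpace.inner_single_right, Real.ringHom_apply, one_mul]
    ring
  have hsq : ∑ i, x i ^ 2 = ‖x‖ ^ 2 := by simp [EuclideanSpace.norm_sq_eq]
  have : ‖x‖ ≠ 0 := norm_ne_zero_iff.2 hx
  simp only [hcoord, Finset.sum_add_distrib, ← Finset.mul_sum, hsq, Finset.sum_const,
    Finset.card_univ, Fintype.card_fin, nsmul_eq_mul, Nat.cast_ofNat]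
  field_simp

lemma sum_inner_single_mul (v x : E3) (c : ℝ) :
    ∑ i, inner ℝ v (EuclideanSpace.single i 1) * (c * x i) = inner ℝ v x * c := by
  simp only [EuclideanSpace.inner_single_right, conj_trivial, one_mul]
  rw [PiLp.inner_apply, Finset.sum_mul]
  simp only [RCLike.inner_apply, conj_trivial]
  exact Finset.sum_congr rfl fun i _ => by ring

lemma IsProfile.div_pow (h : IsProfile α β ψ) (hα : 0 < α) (n : ℕ) :
    IsProfile α β (fun r => ψ r / r ^ n) := by
  induction n with
  | zero => simpa only [pow_zero, div_one] using h
  | succ n ih => simpa only [div_div, ← pow_succ] using ih.div_id hα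

lemma IsWeakGradientOn.radialPair_deriv_div (h : IsWeakGradientOn f g {0}ᶜ)
    (hψ : IsProfile α β ψ) (hα : 0 < α) :
    radialPair f (fun r => deriv ψ r / r) = -∫ x, inner ℝ (g x) x * (ψ ‖x‖ / ‖x‖ ^ 3) := by
  have hκ := hψ.div_pow hα 3
  have hdiv := h.integral_mul_divergence (φ := fun i x => ψ ‖x‖ / ‖x‖ ^ 3 * x i)
    (fun i => (hκ.contDiff_comp_norm hα).mul (EuclideanSpace.proj (𝕜 := ℝ) i).contDiff)
    (fun i => hκ.hasCompactSupport_comp_norm.mul_right)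
    (fun i x hx hx0 => by
      have hαx := (hκ.tsupport_comp_norm_subset (tsupport_mul_subset_left hx)).1
      rw [Set.mem_singleton_iff.1 hx0, norm_zero] at hαx
      linarith)
  simp only [sum_inner_single_mul] at hdiv
  rw [← hdiv]
  refine integral_congr_ae ?_
  filter_upwards [Measure.ae_ne volume (0 : E3)] with x hx
  have hx0 : ‖x‖ ≠ 0 := norm_ne_zero_iff.2 hx
  rw [sum_fderiv_comp_norm_mul_coord (κ := fun r => ψ r / r ^ 3) hx
    ((hψ.hasDerivAt ‖x‖).div (hasDerivAt_pow 3 _) (pow_ne_zero 3 hx0)), smul_eq_mul]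
  push_cast
  field_simp
  ring

end Divergence

section GradientBound

lemma integral_exterior_norm_rpow {r₀ s : ℝ} (hr : 0 < r₀) (hs : s < -3) :
    IntegrableOn (fun x : E3 => ‖x‖ ^ s) {x | r₀ < ‖x‖} ∧
      ∫ x in {x : E3 | r₀ < ‖x‖}, ‖x‖ ^ s = 4 * Real.pi * (-r₀ ^ (s + 3) / (s + 3)) := by
  have hind : ({x : E3 | r₀ < ‖x‖}.indicator fun x : E3 => ‖x‖ ^ s) =
      fun x : E3 => (Set.Ioi r₀).indicator (fun r => r ^ s) ‖x‖ := rfl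
  have hweight : ∀ r ∈ Set.Ioi (0 : ℝ), r ^ 2 * (Set.Ioi r₀).indicator (fun r => r ^ s) r =
      (Set.Ioi r₀).indicator (fun r => r ^ (s + 2)) r := by
    intro r hr0
    by_cases hr' : r ∈ Set.Ioi r₀
    · rw [Set.indicator_of_mem hr', Set.indicator_of_mem hr', Real.rpow_add hr0, Real.rpow_two,
        mul_comm]
    · rw [Set.indicator_of_notMem hr', Set.indicator_of_notMem hr', mul_zero]
  constructor
  · rw [← integrable_indicator_iff (measurableSet_lt_norm r₀), hind,
      integrable_fun_norm_addHaar (volume : Measure E3), finrank_euclideanSpace_fin]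
    refine IntegrableOn.congr_fun ?_ (fun r hr0 => (hweight r hr0).symm) measurableSet_Ioi
    exact ((integrable_indicator_iff measurableSet_Ioi).2
      (integrableOn_Ioi_rpow_of_lt (by linarith) hr)).integrableOn
  · rw [← integral_indicator (measurableSet_lt_norm r₀), hind, integral_comp_norm,
      setIntegral_congr_fun measurableSet_Ioi hweight, setIntegral_indicator measurableSet_Ioi,
      Set.inter_eq_right.2 (Set.Ioi_subset_Ioi hr.le), integral_Ioi_rpow_of_lt (by linarith) hr,
      add_assoc, two_add_one_eq_three]

lemma setOf_lt_norm_subset_iUnion_annulus {E : Type*} [SeminormedAddCommGroup E] {r₀ : ℝ}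
    (hr : 0 < r₀) :
    {x : E | r₀ < ‖x‖} ⊆ ⋃ k : ℕ, {x | 2 ^ k * r₀ < ‖x‖ ∧ ‖x‖ < 4 * (2 ^ k * r₀)} := by
  intro x (hx : r₀ < ‖x‖)
  obtain ⟨n, hlow, hupp⟩ := exists_nat_pow_near (x := ‖x‖ / r₀) (y := 2)
    (by rw [le_div_iff₀ hr]; linarith) one_lt_two
  rw [le_div_iff₀ hr] at hlow
  rw [div_lt_iff₀ hr, pow_succ] at hupp
  have hn : 0 < 2 ^ n * r₀ := by positivity
  rcases hlow.lt_or_eq with hlt | heq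
  · exact Set.mem_iUnion.2 ⟨n, hlt, by linarith⟩
  · rcases n with _ | n
    · rw [pow_zero, one_mul] at heq
      exact absurd heq hx.ne
    · rw [pow_succ] at heq hn
      exact Set.mem_iUnion.2 ⟨n, by linarith, by linarith⟩

lemma lintegral_exterior_le {E : Type*} [SeminormedAddCommGroup E] [MeasurableSpace E]
    {μ : Measure E} {C r₀ : ℝ} {G : E → ℝ≥0∞}
    (h : ∀ r : ℝ, 0 < r → ∫⁻ x in {x | r < ‖x‖ ∧ ‖x‖ < 4 * r}, G x ∂μ ≤ ENNReal.ofReal (C * r⁻¹))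
    (hr : 0 < r₀) : ∫⁻ x in {x | r₀ < ‖x‖}, G x ∂μ ≤ ENNReal.ofReal (2 * |C| / r₀) :=
  calc ∫⁻ x in {x | r₀ < ‖x‖}, G x ∂μ
      ≤ ∫⁻ x in ⋃ k : ℕ, {x | 2 ^ k * r₀ < ‖x‖ ∧ ‖x‖ < 4 * (2 ^ k * r₀)}, G x ∂μ :=
        lintegral_mono_set (setOf_lt_norm_subset_iUnion_annulus hr)
    _ ≤ ∑' k : ℕ, ∫⁻ x in {x | 2 ^ k * r₀ < ‖x‖ ∧ ‖x‖ < 4 * (2 ^ k * r₀)}, G x ∂μ :=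
        lintegral_iUnion_le _ _
    _ ≤ ∑' k : ℕ, ENNReal.ofReal (|C| / r₀ * (1 / 2) ^ k) := by
        refine ENNReal.tsum_le_tsum fun k => (h (2 ^ k * r₀) (by positivity)).trans
          (ENNReal.ofReal_le_ofReal ?_)
        calc C * (2 ^ k * r₀)⁻¹ ≤ |C| * (2 ^ k * r₀)⁻¹ := by gcongr; exact le_abs_self C
          _ = |C| / r₀ * (1 / 2) ^ k := by rw [one_div, inv_pow, mul_inv]; ring
    _ = ENNReal.ofReal (∑' k : ℕ, |C| / r₀ * (1 / 2) ^ k) :=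
        (ENNReal.ofReal_tsum_of_nonneg (fun k => by positivity)
          (summable_geometric_two.mul_left _)).symm
    _ = ENNReal.ofReal (2 * |C| / r₀) := by rw [tsum_mul_left, tsum_geometric_two]; ring_nf

lemma integral_norm_sq_le_of_lintegral_le {X G : Type*} [MeasurableSpace X] [NormedAddCommGroup G]
    {μ : Measure X} {g : X → G} {c : ℝ} (hg : AEStronglyMeasurable g μ) (hc : 0 ≤ c)
    (h : ∫⁻ x, ‖g x‖ₑ ^ 2 ∂μ ≤ ENNReal.ofReal c) :
    Integrable (fun x => ‖g x‖ ^ 2) μ ∧ ∫ x, ‖g x‖ ^ 2 ∂μ ≤ c := by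
  have hnonneg : 0 ≤ᵐ[μ] fun x => ‖g x‖ ^ 2 := Eventually.of_forall fun x => sq_nonneg _
  have hle : ∫⁻ x, ENNReal.ofReal (‖g x‖ ^ 2) ∂μ ≤ ENNReal.ofReal c := by
    simpa only [ENNReal.ofReal_pow (norm_nonneg _), ofReal_norm] using h
  refine ⟨⟨hg.norm.pow 2, ?_⟩, ?_⟩
  · rw [hasFiniteIntegral_iff_ofReal hnonneg]
    exact hle.trans_lt ENNReal.ofReal_lt_top
  · rw [integral_eq_lintegral_of_nonneg_ae hnonneg (hg.norm.pow 2)]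
    exact ENNReal.toReal_le_of_le_ofReal hc hle

lemma setOf_lt_norm_subset_compl_singleton {r₀ : ℝ} (hr : 0 ≤ r₀) :
    {x : E3 | r₀ < ‖x‖} ⊆ {0}ᶜ := fun _ hx => norm_pos_iff.1 (hr.trans_lt hx)

variable {C r₀ : ℝ} {g : E3 → E3}

lemma integral_exterior_norm_div_sq_le (hg : LocallyIntegrableOn g {0}ᶜ)
    (h : ∀ r : ℝ, 0 < r →
      ∫⁻ x in {x | r < ‖x‖ ∧ ‖x‖ < 4 * r}, ‖g x‖ₑ ^ 2 ≤ ENNReal.ofReal (C * r⁻¹)) (hr : 0 < r₀) :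
    IntegrableOn (fun x => ‖g x‖ / ‖x‖ ^ 2) {x | r₀ < ‖x‖} ∧
      ∫ x in {x | r₀ < ‖x‖}, ‖g x‖ / ‖x‖ ^ 2 ≤ (|C| + 2 * Real.pi) / r₀ := by
  have hgm : AEStronglyMeasurable g (volume.restrict {x : E3 | r₀ < ‖x‖}) :=
    hg.aestronglyMeasurable.mono_measure
      (Measure.restrict_mono (setOf_lt_norm_subset_compl_singleton hr.le) le_rfl)
  obtain ⟨hgint, hgle⟩ := integral_norm_sq_le_of_lintegral_le hgm (by positivity)
    (lintegral_exterior_le h hr)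
  obtain ⟨hwint, hwle⟩ := integral_exterior_norm_rpow hr (s := -4) (by norm_num)
  have hyoung (x : E3) : ‖g x‖ / ‖x‖ ^ 2 ≤ 1 / 2 * (‖g x‖ ^ 2 + ‖x‖ ^ (-4 : ℝ)) := by
    have hsq : ‖x‖ ^ (-4 : ℝ) = (‖x‖ ^ 2)⁻¹ ^ 2 := by
      rw [Real.rpow_neg (norm_nonneg x), Real.rpow_ofNat, inv_pow, ← pow_mul]
    rw [hsq, div_eq_mul_inv]
    linarith [two_mul_le_add_sq ‖g x‖ (‖x‖ ^ 2)⁻¹]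
  have hdom := (hgint.add hwint).const_mul (1 / 2)
  have hint : IntegrableOn (fun x => ‖g x‖ / ‖x‖ ^ 2) {x | r₀ < ‖x‖} := by
    refine hdom.mono' (hgm.norm.div₀ (by fun_prop)) (Eventually.of_forall fun x => ?_)
    rw [Real.norm_of_nonneg (by positivity)]
    exact hyoung x
  refine ⟨hint, (setIntegral_mono hint hdom hyoung).trans ?_⟩
  rw [integral_const_mul, integral_add' hgint hwint, hwle]
  calc 1 / 2 * (_ + 4 * Real.pi * (-r₀ ^ (-4 + 3 : ℝ) / (-4 + 3)))
      ≤ 1 / 2 * (2 * |C| / r₀ + 4 * Real.pi * (-r₀ ^ (-4 + 3 : ℝ) / (-4 + 3))) := by gcongr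
    _ = (|C| + 2 * Real.pi) / r₀ := by norm_num [Real.rpow_neg_one]; ring

end GradientBound

section Decay

variable {α β : ℝ} {ϕ ϕ₁ ϕ₂ ψ : ℝ → ℝ}

lemma IsProfile.integral_of_integral_eq_zero (h : IsProfile α β ϕ) (hα : 0 < α)
    (h0 : ∫ r, ϕ r = 0) : IsProfile α β (fun r => ∫ s in (0 : ℝ)..r, ϕ s) := by
  have hd := hasDerivAt_integral_of_continuous h.continuous
  refine ⟨?_, fun r hr => ?_⟩
  · rw [contDiff_infty_iff_deriv, funext fun r => (hd r).deriv]
    exact ⟨fun r => (hd r).differentiableAt, h.smooth⟩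
  rcases lt_or_ge r α with hrα | hrα
  · rw [intervalIntegral.integral_congr (g := fun _ => 0), intervalIntegral.integral_zero]
    exact fun s hs => h.eq_zero s fun hs' =>
      (hs'.1.trans (Set.mem_Icc.1 hs).2).not_gt (max_lt hα hrα)
  · rw [intervalIntegral.integral_eq_integral_of_support_subset, h0]
    intro s hs
    by_contra hs'
    exact hs (h.eq_zero s fun h' => hs' ⟨hα.trans_le h'.1, h'.2.trans
      (not_le.1 fun hrβ => hr ⟨hrα, hrβ⟩).le⟩)

lemma intervalIntegral_mem_Icc {f : ℝ → ℝ} (hf : Integrable f) (hn : ∀ r, 0 ≤ f r) {a b : ℝ}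
    (hab : a ≤ b) : (∫ s in a..b, f s) ∈ Set.Icc 0 (∫ s, f s) := by
  refine ⟨intervalIntegral.integral_nonneg hab fun s _ => hn s, ?_⟩
  rw [intervalIntegral.integral_of_le hab]
  exact setIntegral_le_integral hf (Eventually.of_forall hn)

lemma exists_isProfile_deriv_eq_sub (hα : 0 < α) (h₁ : IsProfile α β ϕ₁) (h₂ : IsProfile α β ϕ₂)
    (hn₁ : ∀ r, 0 ≤ ϕ₁ r) (hn₂ : ∀ r, 0 ≤ ϕ₂ r) (heq : ∫ r, ϕ₂ r = ∫ r, ϕ₁ r) :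
    ∃ ψ, IsProfile α β ψ ∧ deriv ψ = (fun r => ϕ₁ r - ϕ₂ r) ∧
      ∀ r, 0 ≤ r → |ψ r| ≤ ∫ r, ϕ₁ r := by
  have hsub := h₁.sub h₂
  refine ⟨fun r => ∫ s in (0 : ℝ)..r, (ϕ₁ s - ϕ₂ s), hsub.integral_of_integral_eq_zero hα ?_,
    funext fun r => (hasDerivAt_integral_of_continuous hsub.continuous r).deriv, fun r hr => ?_⟩
  · rw [integral_sub h₁.integrable h₂.integrable, heq, sub_self]
  · have hmem₁ := intervalIntegral_mem_Icc h₁.integrable hn₁ hr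
    have hmem₂ := intervalIntegral_mem_Icc h₂.integrable hn₂ hr
    beta_reduce
    rw [intervalIntegral.integral_sub h₁.integrable.intervalIntegrable
      h₂.integrable.intervalIntegrable, abs_le]
    rw [heq] at hmem₂
    constructor <;> linarith [hmem₁.1, hmem₁.2, hmem₂.1, hmem₂.2]

lemma exists_isProfile_integral_eq_one (hαβ : α < β) :
    ∃ η, IsProfile α β η ∧ (∀ r, 0 ≤ η r) ∧ ∫ r, η r = 1 := by
  let b : ContDiffBump ((α + β) / 2) :=
    ⟨(β - α) / 4, (β - α) / 2, by linarith, by linarith⟩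
  refine ⟨b.normed volume, ⟨b.contDiff_normed, fun r hr => ?_⟩, b.nonneg_normed, b.integral_normed⟩
  rw [← Function.notMem_support, b.support_normed_eq, Real.ball_eq_Ioo]
  rintro ⟨hlow : (α + β) / 2 - (β - α) / 2 < r, hupp : r < (α + β) / 2 + (β - α) / 2⟩
  exact hr ⟨by linarith, by linarith⟩

lemma radialPair_const (h : IsProfile α β ϕ) (hα : 0 < α) (c : ℝ) :
    radialPair (fun _ => c) ϕ = 4 * Real.pi * (c * ∫ r, r * ϕ r) := by
  rw [radialPair_eq_integral (v := fun r => c * r) h hα fun x hx =>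
    (mul_div_cancel_right₀ c (hα.trans_le hx).ne').symm]
  simp only [mul_assoc, integral_const_mul]

variable {f : E3 → ℝ} {B C R r₀ m N : ℝ}

/-- The part of the local energy bound that involves the function alone: its weak gradient away
from the origin has square integral at most `C / r` over each annulus `r < |x| < 4r`. -/
def HasGradientBound (C : ℝ) (f : E3 → ℝ) : Prop :=
  ∃ g, IsWeakGradientOn f g {0}ᶜ ∧ ∀ r : ℝ, 0 < r →
    ∫⁻ x in {x | r < ‖x‖ ∧ ‖x‖ < 4 * r}, ‖g x‖ₑ ^ 2 ≤ ENNReal.ofReal (C * r⁻¹)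

lemma HasLocalEnergyBound.hasGradientBound {f₁ : 𝓢'(E3, ℂ)} (h : HasLocalEnergyBound C f f₁) :
    HasGradientBound C f := by
  obtain ⟨g, v, hg, -, hE⟩ := h
  exact ⟨g, hg, fun r hr => (lintegral_mono fun x => le_self_add).trans (hE r hr)⟩

namespace HasGradientBound

lemma locallyIntegrableOn (h : HasGradientBound C f) (hR : 0 ≤ R) :
    LocallyIntegrableOn f {x | R < ‖x‖} := by
  obtain ⟨g, hg, -⟩ := h
  exact hg.1.mono_set (setOf_lt_norm_subset_compl_singleton hR)

lemma abs_radialPair_deriv_div_le (h : HasGradientBound C f) (hr : 0 < r₀) (hα : r₀ < α)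
    (hψ : IsProfile α β ψ) (hm : ∀ r, 0 ≤ r → |ψ r| ≤ m) :
    |radialPair f (fun r => deriv ψ r / r)| ≤ m * ((|C| + 2 * Real.pi) / r₀) := by
  obtain ⟨g, hg, hE⟩ := h
  obtain ⟨hint, hle⟩ := integral_exterior_norm_div_sq_le hg.2.1 hE hr
  have hm0 : 0 ≤ m := (abs_nonneg _).trans (hm 0 le_rfl)
  rw [hg.radialPair_deriv_div hψ (hr.trans hα), abs_neg]
  refine le_trans ?_ (mul_le_mul_of_nonneg_left hle hm0)
  rw [← integral_const_mul, ← integral_indicator (measurableSet_lt_norm r₀)]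
  refine norm_integral_le_of_norm_le (f := fun x => inner ℝ (g x) x * (ψ ‖x‖ / ‖x‖ ^ 3))
    ((integrable_indicator_iff (measurableSet_lt_norm r₀)).2 (hint.const_mul m))
    (Eventually.of_forall fun x => ?_)
  by_cases hx : r₀ < ‖x‖
  · rw [Set.indicator_of_mem (show x ∈ {x : E3 | r₀ < ‖x‖} from hx), norm_mul, norm_div,
      Real.norm_of_nonneg (by positivity : 0 ≤ ‖x‖ ^ 3)]
    have hx0 : ‖x‖ ≠ 0 := (hr.trans hx).ne'
    calc ‖inner ℝ (g x) x‖ * (‖ψ ‖x‖‖ / ‖x‖ ^ 3) ≤ ‖g x‖ * ‖x‖ * (m / ‖x‖ ^ 3) := by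
          gcongr
          · exact norm_inner_le_norm _ _
          · exact hm _ (norm_nonneg _)
      _ = m * (‖g x‖ / ‖x‖ ^ 2) := by field_simp
  · rw [hψ.eq_zero _ fun hx' => hx (hα.trans_le hx'.1), zero_div, mul_zero, norm_zero]
    exact Set.indicator_nonneg (fun y _ => by positivity) x

end HasGradientBound

lemma abs_radialPair_div_le_of_le_div_norm (h : IsProfile N β ϕ) (hn : ∀ r, 0 ≤ ϕ r) (hN : 0 < N)
    (hRN : R < N) (hf : ∀ᵐ x, R < ‖x‖ → |f x| ≤ B / ‖x‖) :
    |radialPair f (fun r => ϕ r / r)| ≤ 4 * Real.pi * (|B| / N * ∫ r, ϕ r) := by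
  have hdiv : ∀ r, 0 ≤ ϕ r / r := fun r => by
    by_cases hr : r ∈ Set.Icc N β
    · exact div_nonneg (hn r) (hN.le.trans hr.1)
    · rw [h.eq_zero r hr, zero_div]
  have hmass : ∫ r, r * (ϕ r / r) = ∫ r, ϕ r := by
    refine integral_congr_ae ?_
    filter_upwards [Measure.ae_ne volume (0 : ℝ)] with r hr using mul_div_cancel₀ (ϕ r) hr
  rw [← hmass, ← radialPair_const (h.div_id hN) hN]
  refine abs_radialPair_le le_rfl hN (h.div_id hN) hdiv
    ((locallyIntegrable_const _).locallyIntegrableOn _) ?_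
  filter_upwards [hf] with x hx hNx
  calc |f x| ≤ B / ‖x‖ := hx (hRN.trans_le hNx)
    _ ≤ |B| / ‖x‖ := by gcongr; exact le_abs_self B
    _ ≤ |B| / N := by gcongr

namespace HasGradientBound

/-- A primitive of `rϕ` need not have compact support, so `rϕ` is first balanced by a bump of the
same mass far out, where `f` is small. -/
lemma abs_radialPair_le_add (h : HasGradientBound C f) (hr : 0 < r₀) (hα : r₀ < α)
    (hϕ : IsProfile α β ϕ) (hn : ∀ r, 0 ≤ ϕ r) (hf : ∀ᵐ x, R < ‖x‖ → |f x| ≤ B / ‖x‖)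
    (hαN : α ≤ N) (hRN : R < N) :
    |radialPair f ϕ| ≤ (|C| + 2 * Real.pi) / r₀ * (∫ r, r * ϕ r) +
      4 * Real.pi * (|B| * ∫ r, r * ϕ r) / N := by
  have hα0 : 0 < α := hr.trans hα
  have hN : 0 < N := hα0.trans_le hαN
  have hid := hϕ.id_mul_nonneg hα0 hn
  set m := ∫ r, r * ϕ r
  have hm0 : 0 ≤ m := integral_nonneg hid
  obtain ⟨η, hη, hηn, hη1⟩ := exists_isProfile_integral_eq_one (lt_add_one N)
  have hmη (r : ℝ) : 0 ≤ m * η r := mul_nonneg hm0 (hηn r)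
  have hmass : ∫ r, m * η r = m := by rw [integral_const_mul, hη1, mul_one]
  have hid' := hϕ.id_mul.mono le_rfl (le_max_left β (N + 1))
  have hη' := (hη.const_mul m).mono hαN (le_max_right β (N + 1))
  obtain ⟨ψ, hψ, hderiv, hψm⟩ := exists_isProfile_deriv_eq_sub hα0 hid' hη' hid hmη hmass
  have hnear := h.abs_radialPair_deriv_div_le hr hα hψ hψm
  have hfar := abs_radialPair_div_le_of_le_div_norm (hη.const_mul m) hmη hN hRN hf
  have hsplit : radialPair f (fun r => deriv ψ r / r) =
      radialPair f ϕ - radialPair f (fun r => m * η r / r) := by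
    rw [eq_sub_iff_add_eq, ← radialPair_add_right le_rfl hα0 (h.locallyIntegrableOn le_rfl)
      (hψ.deriv.div_id hα0) (hη'.div_id hα0), hderiv]
    refine congrArg (radialPair f) (funext fun r => ?_)
    rcases eq_or_ne r 0 with rfl | hr0
    · rw [hϕ.eq_zero 0 fun h0 => h0.1.not_gt hα0, div_zero, div_zero, add_zero]
    · field_simp
      ring
  rw [hmass] at hfar
  rw [hsplit] at hnear
  have htri := abs_sub_abs_le_abs_sub (radialPair f ϕ) (radialPair f fun r => m * η r / r)
  have hcomm : 4 * Real.pi * (|B| * m) / N = 4 * Real.pi * (|B| / N * m) := by ring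
  rw [hcomm]
  linarith

lemma abs_radialPair_le (h : HasGradientBound C f) (hr : 0 < r₀) (hα : r₀ < α)
    (hϕ : IsProfile α β ϕ) (hn : ∀ r, 0 ≤ ϕ r) (hf : ∀ᵐ x, R < ‖x‖ → |f x| ≤ B / ‖x‖) :
    |radialPair f ϕ| ≤ (|C| + 2 * Real.pi) / r₀ * ∫ r, r * ϕ r := by
  have hlim : Tendsto (fun N => (|C| + 2 * Real.pi) / r₀ * (∫ r, r * ϕ r) +
      4 * Real.pi * (|B| * ∫ r, r * ϕ r) / N) atTop
      (𝓝 ((|C| + 2 * Real.pi) / r₀ * (∫ r, r * ϕ r) + 0)) :=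
    (tendsto_const_nhds.div_atTop tendsto_id).const_add _
  rw [add_zero] at hlim
  refine ge_of_tendsto hlim ?_
  filter_upwards [eventually_ge_atTop α, eventually_gt_atTop R] with N hαN hRN
  exact h.abs_radialPair_le_add hr hα hϕ hn hf hαN hRN

lemma ae_abs_le_div (h : HasGradientBound C f) (hrad : IsRadialOn f Set.univ) (hr : 0 < r₀)
    (hf : ∀ᵐ x, R < ‖x‖ → |f x| ≤ B / ‖x‖) :
    ∀ᵐ x, r₀ < ‖x‖ → |f x| ≤ (|C| + 2 * Real.pi) / (4 * Real.pi * r₀) := by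
  refine ae_abs_le_of_abs_radialPair_le hr.le
    (fun x _ y _ hxy => hrad x trivial y trivial hxy) (fun _ _ _ _ _ => rfl)
    (h.locallyIntegrableOn hr.le) ((locallyIntegrable_const _).locallyIntegrableOn _)
    fun {α β ϕ} hα hϕ hn => (h.abs_radialPair_le hr hα hϕ hn hf).trans_eq ?_
  rw [radialPair_const hϕ (hr.trans hα)]
  have hpi := Real.pi_ne_zero
  field_simp

lemma ae_abs_le_div_norm (h : HasGradientBound C f) (hrad : IsRadialOn f Set.univ)
    (hf : ∀ᵐ x, R < ‖x‖ → |f x| ≤ B / ‖x‖) :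
    ∀ᵐ x, |f x| ≤ (|C| + 2 * Real.pi) / (2 * Real.pi) / ‖x‖ := by
  have hdyadic : ∀ᵐ x, ∀ k : ℤ, (2 : ℝ) ^ k < ‖x‖ →
      |f x| ≤ (|C| + 2 * Real.pi) / (4 * Real.pi * 2 ^ k) :=
    ae_all_iff.2 fun k => h.ae_abs_le_div hrad (by positivity) hf
  filter_upwards [hdyadic, Measure.ae_ne volume (0 : E3)] with x hx hx0
  obtain ⟨k, hlow, hupp⟩ := exists_mem_Ioc_zpow (norm_pos_iff.2 hx0) (one_lt_two (α := ℝ))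
  rw [zpow_add_one₀ two_ne_zero] at hupp
  refine (hx k hlow).trans ?_
  rw [div_div]
  refine div_le_div_of_nonneg_left (by positivity) (by positivity) ?_
  calc 2 * Real.pi * ‖x‖ ≤ 2 * Real.pi * (2 ^ k * 2) := by gcongr
    _ = 4 * Real.pi * 2 ^ k := by ring

end HasGradientBound

end Decay

section Rigidity

lemma exists_radius {q : ℝ} (hq : q < 0) (k R : ℝ) :
    ∃ ρ : ℝ, R < ρ ∧ 1 ≤ ρ ∧ k * ρ ^ q ≤ 1 / 2 := by
  have hlim : Tendsto (fun ρ : ℝ => k * ρ ^ q) atTop (𝓝 0) := by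
    simpa only [neg_neg, mul_zero] using (tendsto_rpow_neg_atTop (neg_pos.2 hq)).const_mul k
  exact ((eventually_gt_atTop R).and ((eventually_ge_atTop 1).and
    (hlim.eventually_le_const one_half_pos))).exists

lemma exists_abs_le_div_norm {W : E3 → ℝ} (h : W =O[Bornology.cobounded E3] fun x => 1 / ‖x‖) :
    ∃ K R : ℝ, 0 ≤ K ∧ ∀ x, R < ‖x‖ → |W x| ≤ K / ‖x‖ := by
  obtain ⟨K, hK, hbound⟩ := h.exists_nonneg
  obtain ⟨R, -, hR⟩ := (Filter.hasBasis_cobounded_norm (E := E3)).eventually_iff.1 hbound.bound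
  refine ⟨K, R, hK, fun x hx => ?_⟩
  simpa only [Real.norm_eq_abs, abs_div, abs_one, abs_norm, mul_one_div] using hR hx.le

lemma abs_rpow_le_mul_rpow_neg {s K N a : ℝ} (hs : 0 ≤ s) (hK : 0 ≤ K) (hN : 0 ≤ N)
    (ha : |a| ≤ K / N) : |a| ^ s ≤ K ^ s * N ^ (-s) :=
  (Real.rpow_le_rpow (abs_nonneg _) ha hs).trans_eq <| by
    rw [Real.div_rpow hK hN, Real.rpow_neg hN, div_eq_mul_inv]

lemma abs_sub_le_mul_rpow_mul_abs_sub {s C K₁ K₂ N a b : ℝ} {f : ℝ → ℝ} (hs : 0 ≤ s)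
    (hf : |f a - f b| ≤ C * |a - b| * (|a| ^ s + |b| ^ s)) (hK₁ : 0 ≤ K₁) (hK₂ : 0 ≤ K₂)
    (hN : 0 ≤ N) (ha : |a| ≤ K₁ / N) (hb : |b| ≤ K₂ / N) :
    |f a - f b| ≤ |C| * (K₁ ^ s + K₂ ^ s) * N ^ (-s) * |a - b| :=
  calc |f a - f b| ≤ C * |a - b| * (|a| ^ s + |b| ^ s) := hf
    _ ≤ |C| * |a - b| * (K₁ ^ s * N ^ (-s) + K₂ ^ s * N ^ (-s)) := by
        gcongr
        · exact le_abs_self C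
        · exact abs_rpow_le_mul_rpow_neg hs hK₁ hN ha
        · exact abs_rpow_le_mul_rpow_neg hs hK₂ hN hb
    _ = |C| * (K₁ ^ s + K₂ ^ s) * N ^ (-s) * |a - b| := by ring

lemma abs_sub_le_mul_rpow_of_le_div {q C K₁ K₂ N ρ a b : ℝ} (hq : q ≤ 0) (hK₁ : 0 ≤ K₁)
    (hK₂ : 0 ≤ K₂) (hN : 0 < N) (hfar : ρ < N → |a - b| ≤ C * N ^ (q - 1)) (ha : |a| ≤ K₁ / N)
    (hb : |b| ≤ K₂ / N) : |a - b| ≤ (|C| + (K₁ + K₂) * |ρ| ^ (-q)) * N ^ (q - 1) := by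
  rcases lt_or_ge ρ N with hρ | hρ
  · calc |a - b| ≤ C * N ^ (q - 1) := hfar hρ
      _ ≤ (|C| + (K₁ + K₂) * |ρ| ^ (-q)) * N ^ (q - 1) := by
          gcongr
          exact (le_abs_self C).trans (le_add_of_nonneg_right (by positivity))
  · have hpow : N ^ (-q) ≤ |ρ| ^ (-q) :=
      Real.rpow_le_rpow hN.le (hρ.trans (le_abs_self ρ)) (neg_nonneg.2 hq)
    calc |a - b| ≤ K₁ / N + K₂ / N := (abs_sub a b).trans (add_le_add ha hb)
      _ = (K₁ + K₂) * N ^ (-q) * N ^ (q - 1) := by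
          rw [mul_assoc, ← Real.rpow_add hN, show -q + (q - 1) = -1 by ring, Real.rpow_neg_one,
            ← div_eq_mul_inv, add_div]
      _ ≤ (|C| + (K₁ + K₂) * |ρ| ^ (-q)) * N ^ (q - 1) := by
          gcongr
          exact le_add_of_nonneg_of_le (abs_nonneg C) (by gcongr)

lemma HasGradientBound.ae_abs_le_div_norm_of_sub {C C' K R ρ s : ℝ} {f W : E3 → ℝ}
    (h : HasGradientBound C f) (hrad : IsRadialOn f Set.univ) (hs : s ≤ -1)
    (hW : ∀ x, R < ‖x‖ → |W x| ≤ K / ‖x‖)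
    (hfW : ∀ᵐ x, ρ < ‖x‖ → |f x - W x| ≤ C' * ‖x‖ ^ s) :
    ∀ᵐ x, |f x| ≤ (|C| + 2 * Real.pi) / (2 * Real.pi) / ‖x‖ := by
  refine h.ae_abs_le_div_norm hrad (R := max 1 (max ρ R)) (B := |C'| + K) ?_
  filter_upwards [hfW] with x hx hmax
  obtain ⟨h1, hρ, hR⟩ : 1 < ‖x‖ ∧ ρ < ‖x‖ ∧ R < ‖x‖ := by simpa only [max_lt_iff] using hmax
  calc |f x| ≤ |f x - W x| + |W x| := by linarith [abs_sub_abs_le_abs_sub (f x) (W x)]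
    _ ≤ |C'| * ‖x‖ ^ (-1 : ℝ) + K / ‖x‖ := by
        refine add_le_add ((hx hρ).trans ?_) (hW x hR)
        gcongr
        · exact le_abs_self C'
        · exact h1.le
    _ = (|C'| + K) / ‖x‖ := by rw [Real.rpow_neg_one, ← div_eq_mul_inv, add_div]

namespace IsDuhamelSolution

variable {F : ℝ → ℝ → ℝ} {u : ℝ → E3 → ℝ} {U ut : ℝ → 𝓢'(E3, ℂ)} {W LW : E3 → ℝ}
  {A B K R q s : ℝ}

lemma isVanishingOn {Ω : Set E3} (hu : IsDuhamelSolution F u U ut)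
    (h : ∀ t, ∀ᵐ x, x ∈ Ω → u t x = W x) (t : ℝ) : Distribution.IsVanishingOn (ut t) Ω := by
  intro φ hφ
  have hconst : ∀ τ, U τ φ = ∫ x, φ x * (W x : ℂ) := fun τ => by
    rw [(hu.represents τ φ).2]
    refine integral_congr_ae ?_
    filter_upwards [h τ] with x hx
    by_cases hxφ : x ∈ tsupport φ
    · rw [hx (hφ hxφ)]
    · rw [image_eq_zero_of_notMem_tsupport hxφ, zero_mul, zero_mul]
  have hderiv := hu.time_deriv t φ
  simp only [hconst] at hderiv
  exact hderiv.unique (hasDerivAt_const _ _)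

lemma ae_abs_sub_le_rpow (hu : IsDuhamelSolution F u U ut)
    (hF : ContinuousOn (fun z : ℝ × ℝ => F z.1 z.2) (Set.Ici 0 ×ˢ Set.univ)) (hR : 1 ≤ R)
    (hur : ∀ t, IsRadialOn (u t) {x | R < ‖x‖}) (hWr : IsRadialOn W {x | R < ‖x‖})
    (hul : ∀ t, LocallyIntegrableOn (u t) {x | R < ‖x‖}) (hW : HasRadialLaplacian R W LW)
    (hq : q < 0) (hsq : s ≤ q) (hA : 0 ≤ A) (hB : 0 ≤ B)
    (hD : ∀ t, ∀ᵐ x, R < ‖x‖ → |u t x - W x| ≤ A * ‖x‖ ^ (q - 1))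
    (hforce : ∀ t, ∀ᵐ x, R < ‖x‖ → |F ‖x‖ (u t x) + LW x| ≤ B * ‖x‖ ^ (s - 3)) (t : ℝ) :
    ∀ᵐ x, R < ‖x‖ → |u t x - W x| ≤ B / (s * (s - 1)) * ‖x‖ ^ (s - 1) := by
  have hs : 0 < s * (s - 1) := mul_pos_of_neg_of_neg (by linarith) (by linarith)
  refine hu.ae_abs_sub_le hF (zero_le_one.trans hR) hur hWr
    (fun x _ y _ hxy => by rw [hxy]) hul hW
    ((hasRadialLaplacian_norm_rpow (zero_le_one.trans hR) s).const_mul (B / (s * (s - 1))))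
    (fun t => ?_) hA (div_nonneg hB hs.le) hq hD (Eventually.of_forall fun x hx => ?_) t
  · filter_upwards [hforce t] with x hx hRx
    rw [← mul_assoc, div_mul_cancel₀ B hs.ne']
    exact hx hRx
  · rw [abs_of_nonneg (by positivity)]
    gcongr
    exact hR.trans hx.le

lemma ae_abs_sub_le_half (hu : IsDuhamelSolution F u U ut)
    (hF : ContinuousOn (fun z : ℝ × ℝ => F z.1 z.2) (Set.Ici 0 ×ˢ Set.univ)) (hR : 1 ≤ R)
    (hur : ∀ t, IsRadialOn (u t) {x | R < ‖x‖}) (hWr : IsRadialOn W {x | R < ‖x‖})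
    (hul : ∀ t, LocallyIntegrableOn (u t) {x | R < ‖x‖}) (hW : HasRadialLaplacian R W LW)
    (hq : q < 0) (hA : 0 ≤ A) (hK : 0 ≤ K) (hKR : K / (2 * q * (2 * q - 1)) * R ^ q ≤ 1 / 2)
    (hforce : ∀ t, ∀ᵐ x, R < ‖x‖ → |F ‖x‖ (u t x) + LW x| ≤ K * ‖x‖ ^ (q - 2) * |u t x - W x|)
    (hD : ∀ t, ∀ᵐ x, R < ‖x‖ → |u t x - W x| ≤ A * ‖x‖ ^ (q - 1)) (t : ℝ) :
    ∀ᵐ x, R < ‖x‖ → |u t x - W x| ≤ A / 2 * ‖x‖ ^ (q - 1) := by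
  have hforceA : ∀ t, ∀ᵐ x, R < ‖x‖ → |F ‖x‖ (u t x) + LW x| ≤ K * A * ‖x‖ ^ (2 * q - 3) := by
    intro t
    filter_upwards [hforce t, hD t] with x hx hxA hRx
    calc |F ‖x‖ (u t x) + LW x| ≤ K * ‖x‖ ^ (q - 2) * (A * ‖x‖ ^ (q - 1)) :=
          (hx hRx).trans (mul_le_mul_of_nonneg_left (hxA hRx) (by positivity))
      _ = K * A * ‖x‖ ^ (2 * q - 3) := by
          rw [show 2 * q - 3 = q - 2 + (q - 1) by ring, Real.rpow_add (by linarith)]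
          ring
  filter_upwards [hu.ae_abs_sub_le_rpow hF hR hur hWr hul hW hq (by linarith) hA
    (mul_nonneg hK hA) hD hforceA t] with x hx hRx
  have hκ : 0 < 2 * q * (2 * q - 1) := mul_pos_of_neg_of_neg (by linarith) (by linarith)
  have hpow : ‖x‖ ^ q ≤ R ^ q := Real.rpow_le_rpow_of_nonpos (by linarith) hRx.le hq.le
  calc |u t x - W x| ≤ K * A / (2 * q * (2 * q - 1)) * ‖x‖ ^ (2 * q - 1) := hx hRx
    _ = A * (K / (2 * q * (2 * q - 1)) * ‖x‖ ^ q) * ‖x‖ ^ (q - 1) := by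
        rw [show 2 * q - 1 = q + (q - 1) by ring, Real.rpow_add (by linarith)]
        ring
    _ ≤ A * (K / (2 * q * (2 * q - 1)) * R ^ q) * ‖x‖ ^ (q - 1) := by gcongr
    _ ≤ A * (1 / 2) * ‖x‖ ^ (q - 1) := by gcongr
    _ = A / 2 * ‖x‖ ^ (q - 1) := by ring

lemma ae_eq_of_abs_forcing_le (hu : IsDuhamelSolution F u U ut)
    (hF : ContinuousOn (fun z : ℝ × ℝ => F z.1 z.2) (Set.Ici 0 ×ˢ Set.univ)) (hR : 1 ≤ R)
    (hur : ∀ t, IsRadialOn (u t) {x | R < ‖x‖}) (hWr : IsRadialOn W {x | R < ‖x‖})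
    (hul : ∀ t, LocallyIntegrableOn (u t) {x | R < ‖x‖}) (hW : HasRadialLaplacian R W LW)
    (hq : q < 0) (hA : 0 ≤ A) (hK : 0 ≤ K) (hKR : K / (2 * q * (2 * q - 1)) * R ^ q ≤ 1 / 2)
    (hforce : ∀ t, ∀ᵐ x, R < ‖x‖ → |F ‖x‖ (u t x) + LW x| ≤ K * ‖x‖ ^ (q - 2) * |u t x - W x|)
    (hD : ∀ t, ∀ᵐ x, R < ‖x‖ → |u t x - W x| ≤ A * ‖x‖ ^ (q - 1)) (t : ℝ) :
    ∀ᵐ x, R < ‖x‖ → u t x = W x := by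
  have hiter : ∀ n : ℕ, ∀ t, ∀ᵐ x, R < ‖x‖ → |u t x - W x| ≤ A / 2 ^ n * ‖x‖ ^ (q - 1) := by
    intro n
    induction n with
    | zero => simpa only [pow_zero, div_one] using hD
    | succ n ih =>
      simpa only [pow_succ, ← div_div] using
        hu.ae_abs_sub_le_half hF hR hur hWr hul hW hq (by positivity) hK hKR hforce ih
  filter_upwards [ae_all_iff.2 fun n => hiter n t] with x hx hRx
  have hlim : Tendsto (fun n : ℕ => A / 2 ^ n * ‖x‖ ^ (q - 1)) atTop
      (𝓝 (0 * ‖x‖ ^ (q - 1))) :=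
    (tendsto_const_nhds.div_atTop (tendsto_pow_atTop_atTop_of_one_lt one_lt_two)).mul_const _
  rw [zero_mul] at hlim
  exact sub_eq_zero.1 (abs_nonpos_iff.1 (ge_of_tendsto' hlim fun n => hx n hRx))

end IsDuhamelSolution

end Rigidity

end RadialWave

end

theorem mainTheorem5_general (p : ℝ) (hp : 3 < p) (R_W : ℝ) (W : RadialWave.E3 → ℝ)
    (hW_smooth : ContDiffOn ℝ 2 W {x | R_W < ‖x‖})
    (hW_radial : RadialWave.IsRadialOn W {x | R_W < ‖x‖})
    (hW_decay : W =O[Bornology.cobounded RadialWave.E3] fun x => 1 / ‖x‖) (C₄ C₅ : ℝ) :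
    ∃ R₀ : ℝ, R_W < R₀ ∧
      ∀ F : ℝ → ℝ → ℝ,
        ContinuousOn (fun z : ℝ × ℝ => F z.1 z.2) (Set.Ici 0 ×ˢ Set.univ) →
        (∀ r, 0 ≤ r → ∀ a b,
          |F r a - F r b| ≤ C₅ * |a - b| * (|a| ^ (p - 1) + |b| ^ (p - 1))) →
        (∀ x, R_W < ‖x‖ → -(Δ W x) = F ‖x‖ (W x)) →
        ∀ (u : ℝ → RadialWave.E3 → ℝ) (U ut : ℝ → 𝓢'(RadialWave.E3, ℂ)),
          RadialWave.IsDuhamelSolution F u U ut →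
          (∀ t, RadialWave.IsRadialOn (u t) Set.univ) →
          (∀ t, RadialWave.HasGradientBound C₄ (u t)) →
          (∃ C ρ : ℝ, ∀ t, ∀ᵐ x, ρ < ‖x‖ → |u t x - W x| ≤ C * (1 / ‖x‖ ^ (p - 2))) →
          ∀ t, (∀ᵐ x, R₀ < ‖x‖ → u t x - W x = 0) ∧
            Distribution.IsVanishingOn (ut t) {x | R₀ < ‖x‖} := by
  obtain ⟨K_W, R₁, hK_W, hWle⟩ := RadialWave.exists_abs_le_div_norm hW_decay
  set K₁ : ℝ := (|C₄| + 2 * Real.pi) / (2 * Real.pi)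
  have hK₁ : 0 ≤ K₁ := by positivity
  obtain ⟨R₀, hR₀, hR₀1, hKR⟩ := RadialWave.exists_radius (q := 3 - p) (by linarith)
    (|C₅| * (K₁ ^ (p - 1) + K_W ^ (p - 1)) / (2 * (3 - p) * (2 * (3 - p) - 1))) (max R_W R₁)
  obtain ⟨hRW, hR1⟩ := max_lt_iff.1 hR₀
  have hsub : {x : RadialWave.E3 | R₀ < ‖x‖} ⊆ {x | R_W < ‖x‖} := fun x hx => hRW.trans hx
  have hWr : RadialWave.IsRadialOn W {x | R₀ < ‖x‖} := fun x hx y hy =>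
    hW_radial x (hsub hx) y (hsub hy)
  refine ⟨R₀, hRW, fun F hF hLip hWeq u U ut hu hrad hgrad ⟨C, ρ, hfar⟩ => ?_⟩
  simp only [one_div, ← Real.rpow_neg (norm_nonneg _), show -(p - 2) = 3 - p - 1 by ring] at hfar
  have hu_le : ∀ t, ∀ᵐ x, |u t x| ≤ K₁ / ‖x‖ := fun t =>
    (hgrad t).ae_abs_le_div_norm_of_sub (hrad t) (by linarith) hWle (hfar t)
  have hD : ∀ t, ∀ᵐ x, R₀ < ‖x‖ →
      |u t x - W x| ≤ (|C| + (K₁ + K_W) * |ρ| ^ (-(3 - p))) * ‖x‖ ^ (3 - p - 1) := fun t => by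
    filter_upwards [hfar t, hu_le t] with x hx hux hRx
    exact RadialWave.abs_sub_le_mul_rpow_of_le_div (by linarith) hK₁ hK_W (by linarith) hx hux
      (hWle x (hR1.trans hRx))
  have hforce : ∀ t, ∀ᵐ x, R₀ < ‖x‖ → |F ‖x‖ (u t x) + Δ W x| ≤
      |C₅| * (K₁ ^ (p - 1) + K_W ^ (p - 1)) * ‖x‖ ^ (3 - p - 2) * |u t x - W x| := fun t => by
    filter_upwards [hu_le t] with x hux hRx
    rw [← sub_neg_eq_add, hWeq x (hRW.trans hRx), show 3 - p - 2 = -(p - 1) by ring]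
    exact RadialWave.abs_sub_le_mul_rpow_mul_abs_sub (by linarith) (hLip _ (norm_nonneg x) _ _)
      hK₁ hK_W (norm_nonneg x) hux (hWle x (hR1.trans hRx))
  have heq := hu.ae_eq_of_abs_forcing_le hF hR₀1 (fun t x _ y _ => hrad t x trivial y trivial)
    hWr (fun t => (hgrad t).locallyIntegrableOn (zero_le_one.trans hR₀1))
    (RadialWave.hasRadialLaplacian_laplacian (zero_le_one.trans hR₀1) (hW_smooth.mono hsub) hWr)
    (by linarith) (by positivity) (by positivity) hKR hforce hD
  refine fun t => ⟨?_, hu.isVanishingOn heq t⟩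
  filter_upwards [heq t] with x hx hRx using sub_eq_zero.2 (hx hRx)

theorem mainTheorem5 (p : ℝ) (hp3 : 3 < p) (hp5 : p < 5)
    (R_W : ℝ) (hR_W : 0 ≤ R_W) (W : RadialWave.E3 → ℝ)
    (hW_smooth : ContDiffOn ℝ 2 W {x | R_W < ‖x‖})
    (hW_radial : RadialWave.IsRadialOn W {x | R_W < ‖x‖})
    (hW_decay : W =O[Bornology.cobounded RadialWave.E3] fun x => 1 / ‖x‖)
    (hW_grad : (fun x => gradient W x) =O[Bornology.cobounded RadialWave.E3] fun x => 1 / ‖x‖ ^ 2)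
    (C₄ C₅ : ℝ) :
    -- `R₀` depends only on `p`, `C₄`, `C₅` and `W`
    ∃ R₀ : ℝ, R_W < R₀ ∧
      ∀ F : ℝ → ℝ → ℝ,
        ContinuousOn (fun z : ℝ × ℝ => F z.1 z.2) (Set.Ici 0 ×ˢ Set.univ) →
        (∀ r, 0 ≤ r → ∀ a, |F r a| ≤ |a| ^ p) →
        (∀ r, 0 ≤ r → ∀ a b,
          |F r a - F r b| ≤ C₅ * |a - b| * (|a| ^ (p - 1) + |b| ^ (p - 1))) →
        (∀ x, R_W < ‖x‖ → -(Δ W x) = F ‖x‖ (W x)) →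
        ∀ (u : ℝ → RadialWave.E3 → ℝ) (U ut : ℝ → 𝓢'(RadialWave.E3, ℂ)),
          RadialWave.IsGlobalSolution p F u U ut →
          (∀ t, RadialWave.IsRadialOn (u t) Set.univ) →
          (∀ t, RadialWave.HasLocalEnergyBound C₄ (u t) (ut t)) →
          (∃ C ρ : ℝ, ∀ t, ∀ᵐ x, ρ < ‖x‖ → |u t x - W x| ≤ C * (1 / ‖x‖ ^ (p - 2))) →
          ∀ t, (∀ᵐ x, R₀ < ‖x‖ → u t x - W x = 0) ∧
            Distribution.IsVanishingOn (ut t) {x | R₀ < ‖x‖} := by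
  obtain ⟨R₀, hR₀, h⟩ :=
    mainTheorem5_general p hp3 R_W W hW_smooth hW_radial hW_decay C₄ C₅
  exact ⟨R₀, hR₀, fun F hF _ hLip hWeq u U ut hu hrad hE =>
    h F hF hLip hWeq u U ut hu.isDuhamelSolution hrad fun t => (hE t).hasGradientBound⟩
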